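/- Fix real parameters $\alpha>2$, $\mu>0$, $\beta>0$, $0<\gamma<1$, $N\ge 0$, $M>0$ and an integer $m\ge 1$ with $2\pi/m<\pi/2$. Let $C_1,\dots,C_m$ be the half-open cones of angle $2\pi/m$ with vertex at the origin that partition the plane (up to the vertex), $C_1$ being symmetric about the positive first coordinate axis (up to its boundary). Let $\ell(r)=\min(r^{-\alpha},1)$, and for $0<\epsilon<1$ let $c=M(1-\epsilon)^{-1}$. Network. Let $\Phi$ be the set of nodes, a point process in $\mathbb R^2$. In each time slot $t=0,1,2,\dots$ every node $z\in\Phi$ has a destination cone $z+C_{d(z,t)}$; let $n_t(z)$ be the nearest neighbour of $z$ among the other nodes in this cone, and put $$P_z(t)=\frac{c}{\ell(|z-n_t(z)|)},\qquad p_z(t)=\frac{M}{P_z(t)} .$$ The choices of the cones are arbitrary: they may be random, dependent across nodes and slots, and may depend on $\Phi$ and on the past of the network. In slot $t$, conditionally on $\Phi$, on the cone choices in slots $0,\dots,t$ and on the on/off states and fading powers of the earlier slots, the on/off indicators $\mathbf 1_z(t)$, $z\in\Phi$, are independent with $\mathbb P(\mathbf 1_z(t)=1)=p_z(t)$, and the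 fading powers $h_t(z,y)$, $z,y\in\Phi$, are i.i.d. exponential with parameter $\mu$ and independent of the on/off indicators. For $x,y\in\Phi$ let $$\mathsf{SINR}_{xy}(t)=\frac{P_x(t)\,h_t(x,y)\,\ell(|x-y|)\,\mathbf 1_x(t)\,(1-\mathbf 1_y(t))}{\gamma\sum_{z\in\Phi\setminus\{x,y\}}\mathbf 1_z(t)P_z(t)h_t(z,y)\ell(|z-y|)+N},$$ and let $$T(x)=\min\{t>0:\ \mathsf{SINR}_{x,n_t(x)}(t)>\beta\}\in\{1,2,\dots\}\cup\{\infty\}$$ be the time for a packet to be successfully received at the nearest neighbour of $x$ in its destination cone. Theorem. Suppose $\beta\gamma<1$. Then there is $\epsilon_0\in(0,1]$, not depending on the intensity $\lambda$, such that for every $\epsilon\in(0,\epsilon_0)$, every $\lambda>0$ and every $x\in\mathbb R^2$: if $\Phi$ has the law $\mathbb P^x$, the Palm distribution at $x$ of the homogeneous Poisson point process of intensity $\lambda$ in $\mathbb R^2$, then $$\mathbb E^x\{T(x)\}<\infty .$$ -/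

import Mathlib

open MeasureTheory ProbabilityTheory
open scoped ENNReal NNReal

noncomputable section

/-! ### Point configurations, Poisson processes and Palm distributions in the plane -/

/-- The Euclidean plane. -/
abbrev Plane : Type := EuclideanSpace ℝ (Fin 2)

/-- A locally finite set of points of the plane. -/
@[ext]
structure PointConfig where
  /-- the set of points -/
  points : Set Plane
  locallyFinite : ∀ A : Set Plane, Bornology.IsBounded A → (points ∩ A).Finite

namespace PointConfig

/-- The number of points in `A` (used for bounded `A`, where it is finite). -/
def count (φ : PointConfig) (A : Set Plane) : ℕ := (φ.points ∩ A).ncard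

/-- The usual sigma-algebra on configurations, generated by the numbers of points in bounded
Borel sets. -/
instance : MeasurableSpace PointConfig :=
  ⨆ (A : Set Plane) (_ : MeasurableSet A) (_ : Bornology.IsBounded A),
    MeasurableSpace.comap (fun φ : PointConfig => φ.count A) ⊤

/-- The configuration translated by the vector `v`. -/
def translate (φ : PointConfig) (v : Plane) : PointConfig where
  points := (fun y => y + v) '' φ.points
  locallyFinite := by
    intro A hA
    have hB : Bornology.IsBounded ((fun y : Plane => y + (-v)) '' A) := by
      have hl : LipschitzWith 1 (fun y : Plane => y + (-v)) :=
        LipschitzWith.of_dist_le_mul (by simp)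
      exact hl.isBounded_image hA
    refine ((φ.locallyFinite _ hB).image (fun y => y + v)).subset ?_
    rintro _ ⟨⟨y, hy, rfl⟩, hyA⟩
    exact ⟨y, ⟨hy, ⟨y + v, hyA, by simp⟩⟩, rfl⟩

end PointConfig

/-- `P` is the law of a homogeneous Poisson point process of intensity `lam` in the plane:
counts in bounded Borel sets are Poisson with mean `lam` times the area, and counts in disjoint
sets are independent. -/
structure IsPoissonLaw (lam : ℝ) (P : Measure PointConfig) : Prop where
  isProbabilityMeasure : IsProbabilityMeasure P
  count_law : ∀ A : Set Plane, MeasurableSet A → Bornology.IsBounded A →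
    HasLaw (fun φ : PointConfig => φ.count A)
      (poissonMeasure (Real.toNNReal (lam * (volume : Measure Plane).real A))) P
  count_indep : ∀ (n : ℕ) (A : Fin n → Set Plane), (∀ i, MeasurableSet (A i)) →
    (∀ i, Bornology.IsBounded (A i)) → Pairwise (fun i j => Disjoint (A i) (A j)) →
    iIndepFun (fun i (φ : PointConfig) => φ.count (A i)) P

/-- `Q` is the Palm distribution at the point `x` of a stationary point process with law `P` and
intensity `lam`: for every bounded Borel set `B` and every event `E`, the mean number of points
`y` of the process in `B` from which, after moving `y` to `x`, the configuration lies in `E` is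
`lam * |B| * Q E`. -/
structure IsPalmLaw (lam : ℝ) (P : Measure PointConfig) (x : Plane) (Q : Measure PointConfig) :
    Prop where
  isProbabilityMeasure : IsProbabilityMeasure Q
  campbell : ∀ B : Set Plane, MeasurableSet B → Bornology.IsBounded B →
    ∀ E : Set PointConfig, MeasurableSet E →
    ∫⁻ φ, (({y | y ∈ φ.points ∩ B ∧ φ.translate (x - y) ∈ E}.ncard : ℕ) : ℝ≥0∞) ∂P
      = ENNReal.ofReal lam * volume B * Q E

/-! ### Cones, path loss and the space-time SINR graph -/

/-- The `k`-th of the `m` half-open cones of angle `2π/m` with vertex at the origin. The cone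
with `k = 0` opens to the right and is symmetric about the first axis (up to its boundary).
The vertex itself is left out: it never matters for nearest neighbours. -/
def cone (m : ℕ) (k : Fin m) : Set Plane :=
  {v | ∃ r θ : ℝ, 0 < r ∧
    (2 * (k : ℝ) - 1) * (Real.pi / m) ≤ θ ∧ θ < (2 * (k : ℝ) + 1) * (Real.pi / m) ∧
    v = !₂[r * Real.cos θ, r * Real.sin θ]}

/-- The path loss `min (r ^ (-α)) 1`, for `r > 0`. -/
def pathLoss (α r : ℝ) : ℝ := min (r ^ (-α)) 1

/-- The parameters of the network. -/
structure SINRParams where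
  /-- path-loss exponent -/
  alpha : ℝ
  /-- parameter of the exponential fading -/
  mu : ℝ
  /-- SINR threshold -/
  beta : ℝ
  /-- interference suppression parameter -/
  gamma : ℝ
  /-- noise variance -/
  noise : ℝ
  /-- average power constraint `M` -/
  avgPower : ℝ
  /-- the constant `ε` of the power control -/
  eps : ℝ

/-- The power constant `c = M (1 - ε)⁻¹`. -/
def SINRParams.c (p : SINRParams) : ℝ := p.avgPower * (1 - p.eps)⁻¹

/-- The random data of a network whose nodes are labelled by the natural numbers. -/
structure Network (Ω : Type*) (m : ℕ) where
  /-- the point process of nodes -/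
  config : Ω → PointConfig
  /-- the position of the node with label `i` -/
  pos : ℕ → Ω → Plane
  /-- `dest t i` is the index of the destination cone of node `i` in slot `t` -/
  dest : ℕ → ℕ → Ω → Fin m
  /-- `isOn t i` tells whether node `i` transmits in slot `t` -/
  isOn : ℕ → ℕ → Ω → Bool
  /-- `fade t i j` is the fading power from node `i` to node `j` in slot `t` -/
  fade : ℕ → ℕ → ℕ → Ω → ℝ

namespace Network

variable {Ω : Type*} {m : ℕ}

/-- In slot `t`, node `j` is nearest to node `i` among the nodes other than `i` in the
destination cone of `i`. -/
def IsNearest (S : Network Ω m) (t i j : ℕ) (ω : Ω) : Prop :=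
  j ≠ i ∧ S.pos j ω - S.pos i ω ∈ cone m (S.dest t i ω) ∧
    ∀ k, k ≠ i → S.pos k ω - S.pos i ω ∈ cone m (S.dest t i ω) →
      dist (S.pos i ω) (S.pos j ω) ≤ dist (S.pos i ω) (S.pos k ω)

/-- The label of the nearest neighbour of node `i` in its destination cone in slot `t`
(almost surely there is exactly one). -/
def nn (S : Network Ω m) (t i : ℕ) (ω : Ω) : ℕ := sInf {j | S.IsNearest t i j ω}

/-- The path loss between nodes `i` and `j`. -/
def loss (S : Network Ω m) (p : SINRParams) (i j : ℕ) (ω : Ω) : ℝ :=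
  pathLoss p.alpha (dist (S.pos i ω) (S.pos j ω))

/-- The transmission power of node `i` in slot `t`. -/
def power (S : Network Ω m) (p : SINRParams) (t i : ℕ) (ω : Ω) : ℝ :=
  p.c * (S.loss p i (S.nn t i ω) ω)⁻¹

/-- The transmission probability of node `i` in slot `t`. -/
def txProb (S : Network Ω m) (p : SINRParams) (t i : ℕ) (ω : Ω) : ℝ :=
  p.avgPower * (S.power p t i ω)⁻¹

/-- The interference at node `j` in slot `t` for a transmission from node `i`. -/
def interference (S : Network Ω m) (p : SINRParams) (t i j : ℕ) (ω : Ω) : ℝ≥0∞ :=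
  ∑' z : ℕ, if z ≠ i ∧ z ≠ j ∧ S.isOn t z ω = true then
    ENNReal.ofReal (S.power p t z ω * S.fade t z j ω * S.loss p z j ω) else 0

/-- The signal-to-interference-plus-noise ratio from node `i` to node `j` in slot `t`. -/
def sinr (S : Network Ω m) (p : SINRParams) (t i j : ℕ) (ω : Ω) : ℝ≥0∞ :=
  if S.isOn t i ω = true ∧ S.isOn t j ω = false then
    ENNReal.ofReal (S.power p t i ω * S.fade t i j ω * S.loss p i j ω) /
      (ENNReal.ofReal p.gamma * S.interference p t i j ω + ENNReal.ofReal p.noise)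
  else 0

/-- The first slot `t > 0` in which node `i` transmits successfully to its nearest neighbour in
its destination cone; it is `∞` if there is none. -/
def exitTime (S : Network Ω m) (p : SINRParams) (i : ℕ) (ω : Ω) : ℝ≥0∞ :=
  ⨅ (t : ℕ) (_ : 0 < t ∧ ENNReal.ofReal p.beta < S.sinr p t i (S.nn t i ω) ω), (t : ℝ≥0∞)

/-- The information available just before the coins and the fading of slot `t` are drawn: all
node positions, the destination cones up to and including slot `t`, and the on/off states and
fading powers of the earlier slots. -/
abbrev history (S : Network Ω m) (t : ℕ) : MeasurableSpace Ω :=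
  (⨆ i, MeasurableSpace.comap (S.pos i) inferInstance) ⊔
  (⨆ (s) (_ : s ≤ t) (i), MeasurableSpace.comap (S.dest s i) ⊤) ⊔
  (⨆ (s) (_ : s < t) (i), MeasurableSpace.comap (S.isOn s i) ⊤) ⊔
  (⨆ (s) (_ : s < t) (i) (j), MeasurableSpace.comap (S.fade s i j) inferInstance)

end Network

/-- `S` is a realization, on the probability space `(Ω, Pr)`, of the network with parameters `p`
when the nodes form a point process with law `Q`; the node labelled `0` sits at `x`.
The destination cones are arbitrary: they may be random, dependent on each other and on the
node positions, and may depend on the past of the network. In each slot, conditionally on the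
history, the on/off states are independent, node `i` being on with its prescribed probability, and
the fading powers are independent exponential variables, independent of the on/off states. -/
structure IsNetwork {Ω : Type*} [MeasurableSpace Ω] {m : ℕ} (S : Network Ω m) (p : SINRParams)
    (Pr : Measure Ω) (Q : Measure PointConfig) (x : Plane) : Prop where
  config_law : HasLaw S.config Q Pr
  measurable_pos : ∀ i, Measurable (S.pos i)
  measurable_dest : ∀ t i, Measurable (S.dest t i)
  measurable_isOn : ∀ t i, Measurable (S.isOn t i)
  measurable_fade : ∀ t i j, Measurable (S.fade t i j)
  /-- the labels enumerate the nodes without repetition -/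
  pos_enum : ∀ᵐ ω ∂Pr, Function.Injective (fun i => S.pos i ω) ∧
    Set.range (fun i => S.pos i ω) = (S.config ω).points
  pos_zero : ∀ᵐ ω ∂Pr, S.pos 0 ω = x
  cond_law : ∀ (t : ℕ) (I : Finset ℕ) (b : ℕ → Bool) (J : Finset (ℕ × ℕ)) (A : ℕ × ℕ → Set ℝ),
    (∀ q, MeasurableSet (A q)) →
    Pr⟦{ω | (∀ i ∈ I, S.isOn t i ω = b i) ∧ ∀ q ∈ J, S.fade t q.1 q.2 ω ∈ A q} | S.history t⟧
      =ᵐ[Pr] fun ω =>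
        (∏ i ∈ I, if b i = true then S.txProb p t i ω else 1 - S.txProb p t i ω) *
          ∏ q ∈ J, (expMeasure p.mu).real (A q)

end

/-!
The expected exit time is bounded by the expectation of a random variable `V` that depends only on
the positions of the nodes. Given the past, a slot is a success with probability at least `1 / V`,
so the event `F` that the first slots fail satisfies `P F ≤ ∫ V` over the part of `F` where the next
slot succeeds. These parts are disjoint, and summing over the slots gives `E T ≤ E V`.

The success probability is bounded below by Markov's inequality for the interference: since a node
sends with power `P_z` only with probability `M / P_z`, its conditional mean interference does not
depend on the cone choices. Thus `1 / V` is, up to a constant, the path loss to the nearest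
neighbour times an exponential of the negative shot noise. Summing over the cone and the lattice
cell of the nearest neighbour makes `V` independent of the choices of the cones.

The Palm expectation of `V` becomes a Poisson expectation by the Campbell formula over a unit
square, where the summand of a neighbour at distance `r` requires a ball of radius proportional to
`r` to be void. The Cauchy–Schwarz inequality separates the void probability `exp (-c λ r ^ 2)`,
which beats `r ^ α`, from the exponential moments of the shot noise, which are finite since the
response function is bounded and summable.
-/

section General

variable {Ω ι : Type*} [MeasurableSpace Ω]

theorem measurable_apply_of_countable {β : Type*} [MeasurableSpace β] [Countable ι]
    [MeasurableSpace ι] [MeasurableSingletonClass ι] {f : ι → Ω → β}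
    (hf : ∀ i, Measurable (f i)) {g : Ω → ι} (hg : Measurable g) :
    Measurable fun ω => f (g ω) ω :=
  (measurable_from_prod_countable_right (f := fun q : ι × Ω => f q.1 q.2) hf).comp
    (hg.prodMk measurable_id)

theorem measurable_sInf_nat {B : ℕ → Ω → Prop} (hB : ∀ j, MeasurableSet {ω | B j ω}) :
    Measurable fun ω => sInf {j | B j ω} := by
  classical
  have hex : ∀ ω, ∃ n, B n ω ∨ ∀ k, ¬ B k ω := fun ω => by
    by_cases h : ∃ n, B n ω
    · exact h.imp fun n hn => Or.inl hn
    · exact ⟨0, Or.inr (not_exists.mp h)⟩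
  have hmeas : ∀ n, MeasurableSet {ω | B n ω ∨ ∀ k, ¬ B k ω} := fun n => by
    measurability
  convert measurable_find hex hmeas with ω
  by_cases h : ∃ n, B n ω
  · have hiff : ∀ n, (B n ω ∨ ∀ k, ¬ B k ω) ↔ B n ω := fun n =>
      or_iff_left fun hnone => h.elim hnone
    simp only [hiff]
    exact Nat.sInf_def h
  · have hempty : {j | B j ω} = ∅ := Set.eq_empty_of_forall_notMem (not_exists.mp h)
    rw [hempty, Nat.sInf_empty, eq_comm, Nat.find_eq_zero]
    exact Or.inr (not_exists.mp h)

theorem sum_lintegral_le_lintegral_sum (μ : Measure Ω) (s : Finset ι) (f : ι → Ω → ℝ≥0∞) :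
    ∑ i ∈ s, ∫⁻ ω, f i ω ∂μ ≤ ∫⁻ ω, ∑ i ∈ s, f i ω ∂μ := by
  classical
  induction s using Finset.induction_on with
  | empty => simp
  | insert a s ha ih =>
    simp only [Finset.sum_insert ha]
    exact (add_le_add le_rfl ih).trans (le_lintegral_add _ _)

theorem half_measure_le_measure_inter_lt {μ : Measure Ω} {E : Set Ω} (hE : μ E ≠ ∞)
    {Y : Ω → ℝ≥0∞} (hY : Measurable Y) {r : ℝ≥0∞} (hr0 : r ≠ 0) (hr : r ≠ ∞)
    (h : ∫⁻ ω in E, Y ω ∂μ ≤ r / 2 * μ E) :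
    μ E / 2 ≤ μ (E ∩ {ω | Y ω < r}) := by
  have hYr : MeasurableSet {ω | r ≤ Y ω} := measurableSet_le measurable_const hY
  have hlarge : μ (E ∩ {ω | r ≤ Y ω}) ≤ μ E / 2 := by
    have hmarkov := mul_meas_ge_le_lintegral (μ := μ.restrict E) hY r
    rw [Measure.restrict_apply hYr, Set.inter_comm] at hmarkov
    refine (ENNReal.mul_le_mul_iff_right hr0 hr).mp ((hmarkov.trans h).trans_eq ?_)
    rw [ENNReal.mul_comm_div]
  have hhalf : μ E / 2 ≠ ∞ := ENNReal.div_ne_top hE two_ne_zero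
  refine (ENNReal.add_le_add_iff_left hhalf).mp ?_
  calc μ E / 2 + μ E / 2 = μ E := ENNReal.add_halves _
    _ ≤ μ (E ∩ {ω | r ≤ Y ω}) + μ (E \ {ω | r ≤ Y ω}) := measure_le_inter_add_sdiff _ _ _
    _ ≤ μ E / 2 + μ (E ∩ {ω | Y ω < r}) := by
        gcongr
        exact fun ω hω => ⟨hω.1, by simpa using hω.2⟩

theorem lintegral_eq_tsum_setLIntegral_fiber [Countable ι] [MeasurableSpace ι]
    [MeasurableSingletonClass ι] (μ : Measure Ω) {X : Ω → ι} (hX : Measurable X)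
    (f : Ω → ℝ≥0∞) : ∫⁻ ω, f ω ∂μ = ∑' q, ∫⁻ ω in X ⁻¹' {q}, f ω ∂μ := by
  rw [← lintegral_iUnion (fun q => hX (measurableSet_singleton q))
    (fun q q' hqq => (Set.disjoint_singleton.mpr hqq).preimage X), ← Set.preimage_iUnion,
    Set.iUnion_of_singleton, Set.preimage_univ, Measure.restrict_univ]

theorem setLIntegral_le_measure_inter_of_fiber [Countable ι] [MeasurableSpace ι]
    [MeasurableSingletonClass ι] {μ : Measure Ω} {X : Ω → ι} (hX : Measurable X)
    {f : Ω → ℝ≥0∞} {G H : Set Ω}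
    (h : ∀ q, ∫⁻ ω in X ⁻¹' {q} ∩ H, f ω ∂μ ≤ μ (X ⁻¹' {q} ∩ H ∩ G)) :
    ∫⁻ ω in H, f ω ∂μ ≤ μ (H ∩ G) := by
  have hfib := fun q => hX (measurableSet_singleton q)
  calc ∫⁻ ω in H, f ω ∂μ = ∑' q, ∫⁻ ω in X ⁻¹' {q} ∩ H, f ω ∂μ := by
        rw [lintegral_eq_tsum_setLIntegral_fiber _ hX]
        simp only [Measure.restrict_restrict (hfib _)]
    _ ≤ ∑' q, μ (X ⁻¹' {q} ∩ H ∩ G) := ENNReal.tsum_le_tsum h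
    _ = ∑' q, ∫⁻ _ in X ⁻¹' {q}, 1 ∂μ.restrict (H ∩ G) := by
        simp only [setLIntegral_one, Measure.restrict_apply (hfib _), Set.inter_assoc]
    _ = μ (H ∩ G) := by
        rw [← lintegral_eq_tsum_setLIntegral_fiber _ hX, lintegral_one, Measure.restrict_apply_univ]

end General

theorem measure_le_setLIntegral_inter {Ω : Type*} {𝓗 mΩ : MeasurableSpace Ω} (h𝓗 : 𝓗 ≤ mΩ)
    {μ : Measure Ω} {V : Ω → ℝ≥0∞} (hV : Measurable[𝓗] V) (hV0 : ∀ᵐ ω ∂μ, V ω ≠ 0)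
    (hVt : ∀ᵐ ω ∂μ, V ω ≠ ∞) {G : Set Ω}
    (h : ∀ H, MeasurableSet[𝓗] H → ∫⁻ ω in H, (V ω)⁻¹ ∂μ ≤ μ (H ∩ G))
    {H : Set Ω} (hH : MeasurableSet[𝓗] H) : μ H ≤ ∫⁻ ω in H ∩ G, V ω ∂μ := by
  have hle : (μ.withDensity fun ω => (V ω)⁻¹).trim h𝓗 ≤ (μ.restrict G).trim h𝓗 := by
    refine Measure.le_iff.mpr fun s hs => ?_
    rw [trim_measurableSet_eq h𝓗 hs, trim_measurableSet_eq h𝓗 hs,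
      Measure.restrict_apply (h𝓗 _ hs), withDensity_apply _ (h𝓗 _ hs)]
    exact h s hs
  have hVm : Measurable V := hV.mono h𝓗 le_rfl
  have hind : Measurable[𝓗] (H.indicator V) := hV.indicator hH
  calc μ H = ∫⁻ ω, (V ω)⁻¹ * H.indicator V ω ∂μ := by
        rw [← lintegral_indicator_one (h𝓗 _ hH)]
        refine lintegral_congr_ae ?_
        filter_upwards [hV0, hVt] with ω h0 ht
        by_cases hω : ω ∈ H
        · simp [hω, ENNReal.inv_mul_cancel h0 ht]
        · simp [hω]
    _ = ∫⁻ ω, H.indicator V ω ∂(μ.withDensity fun ω => (V ω)⁻¹) :=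
        (lintegral_withDensity_eq_lintegral_mul _ hVm.inv (hind.mono h𝓗 le_rfl)).symm
    _ ≤ ∫⁻ ω, H.indicator V ω ∂μ.restrict G := by
        rw [← lintegral_trim h𝓗 hind, ← lintegral_trim h𝓗 hind]
        exact lintegral_mono' hle le_rfl
    _ = ∫⁻ ω in H ∩ G, V ω ∂μ := by
        rw [lintegral_indicator (h𝓗 _ hH), Measure.restrict_restrict (h𝓗 _ hH)]

theorem setLIntegral_inter_eq_setLIntegral_mul {Ω : Type*} {𝓗 mΩ : MeasurableSpace Ω}
    {μ : Measure Ω} (h𝓗 : 𝓗 ≤ mΩ) {E : Set Ω} {D : Ω → ℝ≥0∞}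
    (hD : Measurable[𝓗] D) (h : ∀ H, MeasurableSet[𝓗] H → μ (H ∩ E) = ∫⁻ ω in H, D ω ∂μ)
    {f : Ω → ℝ≥0∞} (hf : Measurable[𝓗] f) {H : Set Ω} (hH : MeasurableSet[𝓗] H) :
    ∫⁻ ω in H ∩ E, f ω ∂μ = ∫⁻ ω in H, f ω * D ω ∂μ := by
  have htrim : (μ.restrict E).trim h𝓗 = (μ.withDensity D).trim h𝓗 := by
    refine @Measure.ext _ 𝓗 _ _ fun G hG => ?_
    rw [trim_measurableSet_eq h𝓗 hG, trim_measurableSet_eq h𝓗 hG,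
      Measure.restrict_apply (h𝓗 _ hG), withDensity_apply _ (h𝓗 _ hG), h G hG]
  rw [← Measure.restrict_restrict (h𝓗 _ hH), ← setLIntegral_trim h𝓗 hf hH, htrim,
    setLIntegral_trim h𝓗 hf hH, setLIntegral_withDensity_eq_setLIntegral_mul _
      (hD.mono h𝓗 le_rfl) (hf.mono h𝓗 le_rfl) (h𝓗 _ hH)]
  simp only [Pi.mul_apply, mul_comm]

theorem setLIntegral_mul_comp_eq {Ω β : Type*} {mΩ : MeasurableSpace Ω} [MeasurableSpace β]
    {μ : Measure Ω} {ν : Measure β} {E : Set Ω} (hE : MeasurableSet E) {X : Ω → β}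
    (hX : Measurable X) {f : Ω → ℝ≥0∞} (hf : Measurable f) {κ : ℝ≥0∞}
    (h : ∀ B, MeasurableSet B → ∫⁻ ω in E ∩ X ⁻¹' B, f ω ∂μ = κ * ν B)
    {g : β → ℝ≥0∞} (hg : Measurable g) :
    ∫⁻ ω in E, f ω * g (X ω) ∂μ = κ * ∫⁻ y, g y ∂ν := by
  have hmap : ((μ.withDensity f).restrict E).map X = κ • ν := by
    ext B hB
    rw [Measure.map_apply hX hB, Measure.restrict_apply (hX hB), Set.inter_comm,
      withDensity_apply _ (hE.inter (hX hB)), h B hB, Measure.smul_apply, smul_eq_mul]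
  rw [← smul_eq_mul, ← lintegral_smul_measure, ← hmap, lintegral_map hg hX]
  exact (setLIntegral_withDensity_eq_setLIntegral_mul _ hf (hg.comp hX) hE).symm

section HittingTime

variable {Ω : Type*}

/-- The event that none of `G 1, …, G n` occurs. -/
def missedUpTo (G : ℕ → Set Ω) (n : ℕ) : Set Ω := ⋂ s ∈ Finset.Icc 1 n, (G s)ᶜ

theorem mem_missedUpTo {G : ℕ → Set Ω} {n : ℕ} {ω : Ω} :
    ω ∈ missedUpTo G n ↔ ∀ s, 0 < s → s ≤ n → ω ∉ G s := by
  simp [missedUpTo, Nat.succ_le_iff]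

theorem iInf_hit_le_tsum_missedUpTo (G : ℕ → Set Ω) (ω : Ω) :
    ⨅ (t : ℕ) (_ : 0 < t ∧ ω ∈ G t), (t : ℝ≥0∞) ≤ ∑' n, (missedUpTo G n).indicator 1 ω := by
  classical
  by_cases hex : ∃ t, 0 < t ∧ ω ∈ G t
  · have hmiss : ∀ n ∈ Finset.range (Nat.find hex), (missedUpTo G n).indicator 1 ω = (1 : ℝ≥0∞) :=
      fun n hn => Set.indicator_of_mem (mem_missedUpTo.mpr fun s hs hsn hsG =>
        Nat.find_min hex (hsn.trans_lt (Finset.mem_range.mp hn)) ⟨hs, hsG⟩) _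
    calc ⨅ (t : ℕ) (_ : 0 < t ∧ ω ∈ G t), (t : ℝ≥0∞) ≤ (Nat.find hex : ℝ≥0∞) :=
          iInf₂_le (f := fun (t : ℕ) (_ : 0 < t ∧ ω ∈ G t) => (t : ℝ≥0∞)) _ (Nat.find_spec hex)
      _ = ∑ n ∈ Finset.range (Nat.find hex), (missedUpTo G n).indicator 1 ω := by
          rw [Finset.sum_congr rfl hmiss, Finset.sum_const, Finset.card_range, nsmul_one]
      _ ≤ ∑' n, (missedUpTo G n).indicator 1 ω := ENNReal.sum_le_tsum _
  · push Not at hex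
    have hmiss : ∀ n, (missedUpTo G n).indicator (1 : Ω → ℝ≥0∞) ω = 1 := fun n =>
      Set.indicator_of_mem (mem_missedUpTo.mpr fun s hs _ => hex s hs) _
    simp [hmiss]

theorem pairwise_disjoint_missedUpTo_inter (G : ℕ → Set Ω) :
    Pairwise (Function.onFun Disjoint fun n => missedUpTo G n ∩ G (n + 1)) :=
  (pairwise_disjoint_on _).mpr fun a _ hab => Set.disjoint_left.mpr fun _ hω hω' =>
    mem_missedUpTo.mp hω'.1 (a + 1) a.succ_pos hab hω.2

/-- The events `missedUpTo G n ∩ G (n + 1)` are disjoint, so the bounds `hbound` add up. -/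
theorem lintegral_iInf_hit_le [MeasurableSpace Ω] {μ : Measure Ω} {G : ℕ → Set Ω}
    (hG : ∀ t, MeasurableSet (G t)) {V : Ω → ℝ≥0∞}
    (hbound : ∀ n, μ (missedUpTo G n) ≤ ∫⁻ ω in missedUpTo G n ∩ G (n + 1), V ω ∂μ) :
    ∫⁻ ω, ⨅ (t : ℕ) (_ : 0 < t ∧ ω ∈ G t), (t : ℝ≥0∞) ∂μ ≤ ∫⁻ ω, V ω ∂μ := by
  have hF : ∀ n, MeasurableSet (missedUpTo G n) := fun n =>
    Finset.measurableSet_biInter _ fun s _ => (hG s).compl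
  calc ∫⁻ ω, ⨅ (t : ℕ) (_ : 0 < t ∧ ω ∈ G t), (t : ℝ≥0∞) ∂μ
      ≤ ∫⁻ ω, ∑' n, (missedUpTo G n).indicator 1 ω ∂μ :=
        lintegral_mono (iInf_hit_le_tsum_missedUpTo G)
    _ = ∑' n, ∫⁻ ω, (missedUpTo G n).indicator 1 ω ∂μ :=
        lintegral_tsum fun n => (measurable_one.indicator (hF n)).aemeasurable
    _ = ∑' n, μ (missedUpTo G n) := by simp only [lintegral_indicator_one (hF _)]
    _ ≤ ∑' n, ∫⁻ ω in missedUpTo G n ∩ G (n + 1), V ω ∂μ := ENNReal.tsum_le_tsum hbound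
    _ = ∫⁻ ω in ⋃ n, missedUpTo G n ∩ G (n + 1), V ω ∂μ :=
        (lintegral_iUnion (fun n => (hF n).inter (hG _))
          (pairwise_disjoint_missedUpTo_inter G) _).symm
    _ ≤ ∫⁻ ω, V ω ∂μ := setLIntegral_le_lintegral _ _

end HittingTime

section Exponential

/-- The exponential function on `[0, ∞]`, with `eexp ∞ = ∞`. It expresses exponential moments of
nonnegative random variables without integrability assumptions. -/
noncomputable def eexp (s : ℝ≥0∞) : ℝ≥0∞ := EReal.exp s

theorem eexp_ofReal {s : ℝ} (hs : 0 ≤ s) :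
    eexp (ENNReal.ofReal s) = ENNReal.ofReal (Real.exp s) := by
  rw [eexp, EReal.coe_ennreal_ofReal, max_eq_left hs, EReal.exp_coe]

theorem one_le_eexp (s : ℝ≥0∞) : 1 ≤ eexp s := EReal.one_le_exp_iff.mpr (EReal.coe_ennreal_nonneg s)

theorem eexp_top : eexp ∞ = ∞ := by simp [eexp]

theorem eexp_mono : Monotone eexp := fun _ _ h =>
  EReal.exp_monotone (EReal.coe_ennreal_le_coe_ennreal_iff.mpr h)

theorem eexp_add (s t : ℝ≥0∞) : eexp (s + t) = eexp s * eexp t := by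
  rw [eexp, EReal.coe_ennreal_add, EReal.exp_add, eexp, eexp]

theorem continuous_eexp : Continuous eexp :=
  EReal.expHomeomorph.continuous.comp continuous_coe_ennreal_ereal

theorem eexp_sum {ι : Type*} (s : Finset ι) (f : ι → ℝ≥0∞) :
    eexp (∑ i ∈ s, f i) = ∏ i ∈ s, eexp (f i) := by
  classical
  induction s using Finset.induction_on with
  | empty => simp [eexp]
  | insert a s ha ih => rw [Finset.sum_insert ha, Finset.prod_insert ha, eexp_add, ih]

theorem eexp_tsum {ι : Type*} (f : ι → ℝ≥0∞) :
    eexp (∑' i, f i) = ⨆ s : Finset ι, ∏ i ∈ s, eexp (f i) := by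
  simp only [← eexp_sum]
  have hmono : Monotone fun s : Finset ι => eexp (∑ i ∈ s, f i) := fun s t hst =>
    eexp_mono (Finset.sum_le_sum_of_subset hst)
  exact tendsto_nhds_unique ((continuous_eexp.tendsto _).comp ENNReal.summable.hasSum)
    (tendsto_atTop_iSup hmono)

theorem natCast_le_eexp (n : ℕ) : (n : ℝ≥0∞) ≤ eexp n := by
  rw [← ENNReal.ofReal_natCast, eexp_ofReal n.cast_nonneg]
  exact ENNReal.ofReal_le_ofReal (by linarith [Real.add_one_le_exp (n : ℝ)])

end Exponential

section Distributions

/-- The mean of the exponential distribution with parameter `μ`, which is the mean fading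
power. -/
noncomputable def meanFade (μ : ℝ) : ℝ≥0∞ := ∫⁻ s, ENNReal.ofReal s ∂expMeasure μ

theorem meanFade_lt_top {μ : ℝ} (hμ : 0 < μ) : meanFade μ < ∞ := by
  have hint : IntegrableOn (fun s : ℝ => μ * (s ^ (1 : ℝ) * Real.exp (-μ * s ^ (1 : ℝ))))
      (Set.Ioi 0) :=
    (integrableOn_rpow_mul_exp_neg_mul_rpow (by norm_num) one_pos hμ).const_mul μ
  have hpdf : Measurable (exponentialPDF μ) := (measurable_exponentialPDFReal μ).ennreal_ofReal
  change ∫⁻ s, ENNReal.ofReal s ∂(volume.withDensity (exponentialPDF μ)) < ∞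
  rw [lintegral_withDensity_eq_lintegral_mul _ hpdf ENNReal.measurable_ofReal]
  refine lt_of_le_of_lt ?_ hint.setLIntegral_lt_top
  rw [← lintegral_indicator measurableSet_Ioi]
  refine lintegral_mono fun s => ?_
  rcases le_or_gt s 0 with hs | hs
  · simp [ENNReal.ofReal_of_nonpos hs]
  · rw [Set.indicator_of_mem (Set.mem_Ioi.mpr hs), Pi.mul_apply, exponentialPDF_of_nonneg hs.le,
      ← ENNReal.ofReal_mul (by positivity), Real.rpow_one, neg_mul, mul_comm s, mul_assoc]

theorem expMeasure_Ioi {μ : ℝ} (hμ : 0 < μ) {s : ℝ} (hs : 0 ≤ s) :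
    expMeasure μ (Set.Ioi s) = ENNReal.ofReal (Real.exp (-(μ * s))) := by
  have := isProbabilityMeasure_expMeasure hμ
  have hcdf : (expMeasure μ).real (Set.Iic s) = 1 - Real.exp (-(μ * s)) := by
    rw [← cdf_eq_real, cdf_expMeasure_eq hμ, if_pos hs]
  rw [← ofReal_measureReal, ← Set.compl_Iic, probReal_compl_eq_one_sub measurableSet_Iic, hcdf,
    sub_sub_cancel]

theorem lintegral_eexp_poissonMeasure (r : ℝ≥0) {g : ℝ} (hg : 0 ≤ g) :
    ∫⁻ n, eexp (n * ENNReal.ofReal g) ∂poissonMeasure r =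
      ENNReal.ofReal (Real.exp (r * (Real.exp g - 1))) := by
  have hsum : HasSum (fun n : ℕ => Real.exp (-r) * ((r * Real.exp g) ^ n / n.factorial))
      (Real.exp (r * (Real.exp g - 1))) := by
    have h := (NormedSpace.expSeries_div_hasSum_exp ((r : ℝ) * Real.exp g)).mul_left (Real.exp (-r))
    rwa [← Real.exp_eq_exp_ℝ, ← Real.exp_add, ← sub_eq_neg_add, ← mul_sub_one] at h
  rw [lintegral_countable', ← hsum.tsum_eq,
    ENNReal.ofReal_tsum_of_nonneg (fun n => by positivity) hsum.summable]
  refine tsum_congr fun n => ?_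
  rw [poissonMeasure_singleton, ← ENNReal.ofReal_natCast n, ← ENNReal.ofReal_mul n.cast_nonneg,
    eexp_ofReal (by positivity), ← ENNReal.ofReal_mul (Real.exp_pos _).le, Real.exp_nat_mul]
  congr 1
  ring

end Distributions

section Cones

theorem measurableSet_cone (m : ℕ) (k : Fin m) : MeasurableSet (cone m k) := by
  let box : Set (ℝ × ℝ) := Set.Ioi 0 ×ˢ
    Set.Ico ((2 * (k : ℝ) - 1) * (Real.pi / m)) ((2 * (k : ℝ) + 1) * (Real.pi / m))
  have hcone : cone m k =
      (fun q : ℝ × ℝ => (!₂[q.1 * Real.cos q.2, q.1 * Real.sin q.2] : Plane)) '' box := by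
    ext v
    exact ⟨fun ⟨r, θ, hr, h₁, h₂, hv⟩ => ⟨(r, θ), ⟨hr, h₁, h₂⟩, hv.symm⟩,
      fun ⟨q, ⟨hr, h₁, h₂⟩, hv⟩ => ⟨q.1, q.2, hr, h₁, h₂, hv.symm⟩⟩
  have hcont : Continuous fun q : ℝ × ℝ =>
      (!₂[q.1 * Real.cos q.2, q.1 * Real.sin q.2] : Plane) := by fun_prop
  have hbox : IsLocallyClosed box :=
    (isOpen_Ioi.isLocallyClosed.preimage continuous_fst).inter
      (isLocallyClosed_Ico.preimage continuous_snd)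
  have := hbox.locallyCompactSpace
  have hsigma : IsSigmaCompact box := isSigmaCompact_iff_sigmaCompactSpace.mpr inferInstance
  obtain ⟨K, hK, hKbox⟩ := hsigma.image hcont
  rw [hcone, ← hKbox]
  exact MeasurableSet.iUnion fun n => (hK n).measurableSet

theorem re_pos_of_norm_sub_lt {w : ℂ} {s δ : ℝ} (hδ₀ : 0 < δ) (hδ : δ < Real.pi)
    (h : ‖w - s‖ < s * Real.sin δ) : 0 < w.re := by
  have hsin : 0 < Real.sin δ := Real.sin_pos_of_pos_of_lt_pi hδ₀ hδ
  have hs : 0 ≤ s := (pos_of_mul_pos_left ((norm_nonneg _).trans_lt h) hsin.le).le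
  have hle : s * Real.sin δ ≤ s := mul_le_of_le_one_right hs (Real.sin_le_one δ)
  have hre := neg_le_of_abs_le (Complex.abs_re_le_norm (w - s))
  rw [Complex.sub_re, Complex.ofReal_re] at hre
  linarith

theorem neg_lt_arg_of_norm_sub_lt {w : ℂ} {s δ : ℝ} (hδ₀ : 0 < δ) (hδ : δ < Real.pi / 2)
    (h : ‖w - s‖ < s * Real.sin δ) : -δ < w.arg := by
  have hw := re_pos_of_norm_sub_lt hδ₀ (by linarith) h
  have hrot : ((w - s) * Complex.exp (δ * Complex.I)).im =
      ‖w‖ * Real.sin (w.arg + δ) - s * Real.sin δ := by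
    rw [Complex.exp_mul_I, ← Complex.ofReal_cos, ← Complex.ofReal_sin, Real.sin_add]
    simp only [Complex.mul_im, Complex.sub_re, Complex.sub_im, Complex.add_re, Complex.add_im,
      Complex.ofReal_re, Complex.ofReal_im, Complex.re_ofReal_mul,
      Complex.I_re, Complex.I_im]
    linear_combination -Real.sin δ * Complex.norm_mul_cos_arg w -
      Real.cos δ * Complex.norm_mul_sin_arg w
  have hprod : 0 < ‖w‖ * Real.sin (w.arg + δ) := by
    have hle := Complex.abs_im_le_norm ((w - s) * Complex.exp (δ * Complex.I))
    rw [norm_mul, Complex.norm_exp_ofReal_mul_I, mul_one, hrot] at hle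
    linarith [neg_le_of_abs_le hle]
  have harg := abs_lt.mp (Complex.abs_arg_lt_pi_div_two_iff.mpr (Or.inl hw))
  have hsin : 0 < Real.sin (w.arg + δ) := pos_of_mul_pos_right hprod (norm_nonneg w)
  by_contra! hle
  exact hsin.not_ge
    (Real.sin_nonpos_of_nonpos_of_neg_pi_le (by linarith) (by linarith [Real.pi_pos]))

theorem abs_arg_lt_of_norm_sub_lt {w : ℂ} {s δ : ℝ} (hδ₀ : 0 < δ) (hδ : δ < Real.pi / 2)
    (h : ‖w - s‖ < s * Real.sin δ) : |w.arg| < δ := by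
  have harg : w.arg ≠ Real.pi := fun hπ =>
    (re_pos_of_norm_sub_lt hδ₀ (by linarith) h).not_gt (Complex.arg_eq_pi_iff.mp hπ).1
  have hconj : ‖(starRingEnd ℂ) w - s‖ < s * Real.sin δ := by
    rwa [← Complex.conj_ofReal, ← map_sub, Complex.norm_conj]
  have hupper := neg_lt_arg_of_norm_sub_lt hδ₀ hδ hconj
  rw [Complex.arg_conj, if_neg harg] at hupper
  exact abs_lt.mpr ⟨neg_lt_arg_of_norm_sub_lt hδ₀ hδ h, neg_lt_neg_iff.mp hupper⟩

/-- The isometric identification of `ℂ` with the plane. -/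
noncomputable def complexToPlane : ℂ ≃ₗᵢ[ℝ] Plane := Complex.orthonormalBasisOneI.repr

theorem complexToPlane_polar (r θ : ℝ) :
    complexToPlane (r * Complex.exp (θ * Complex.I)) = !₂[r * Real.cos θ, r * Real.sin θ] := by
  ext i
  simp [complexToPlane, Complex.exp_ofReal_mul_I_re, Complex.exp_ofReal_mul_I_im]

/-- The angle of the axis of the `k`-th cone. -/
noncomputable def coneAngle (m : ℕ) (k : Fin m) : ℝ := 2 * k * (Real.pi / m)

/-- The unit vector on the axis of the `k`-th cone. -/
noncomputable def coneAxis (m : ℕ) (k : Fin m) : Plane :=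
  complexToPlane (Complex.exp (coneAngle m k * Complex.I))

theorem norm_coneAxis (m : ℕ) (k : Fin m) : ‖coneAxis m k‖ = 1 := by
  rw [coneAxis, LinearIsometryEquiv.norm_map, Complex.norm_exp_ofReal_mul_I]

theorem complexToPlane_mem_cone {m : ℕ} {k : Fin m} {w : ℂ} (hw : w ≠ 0)
    (harg : |w.arg| < Real.pi / m) :
    complexToPlane (w * Complex.exp (coneAngle m k * Complex.I)) ∈ cone m k := by
  obtain ⟨hlo, hhi⟩ := abs_lt.mp harg
  refine ⟨‖w‖, w.arg + coneAngle m k, norm_pos_iff.mpr hw, ?_, ?_, ?_⟩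
  · rw [coneAngle]
    linarith
  · rw [coneAngle]
    linarith
  · rw [← complexToPlane_polar, Complex.ofReal_add, add_mul, Complex.exp_add, ← mul_assoc,
      Complex.norm_mul_exp_arg_mul_I]

theorem zero_notMem_cone (m : ℕ) (k : Fin m) : (0 : Plane) ∉ cone m k := by
  rintro ⟨r, θ, hr, -, -, h⟩
  rw [← complexToPlane_polar, eq_comm, EmbeddingLike.map_eq_zero_iff] at h
  exact mul_ne_zero (Complex.ofReal_ne_zero.mpr hr.ne') (Complex.exp_ne_zero _) h

theorem ball_subset_cone {m : ℕ} (hm : 2 < m) (k : Fin m) (s : ℝ) :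
    Metric.ball (s • coneAxis m k) (s * Real.sin (Real.pi / m)) ⊆ cone m k := by
  intro v hv
  have hm' : (2 : ℝ) < m := by exact_mod_cast hm
  have hδ₀ : 0 < Real.pi / m := div_pos Real.pi_pos (by linarith)
  have hδ : Real.pi / m < Real.pi / 2 := div_lt_div_of_pos_left Real.pi_pos two_pos hm'
  let e : ℂ := Complex.exp (coneAngle m k * Complex.I)
  let w : ℂ := complexToPlane.symm v * e⁻¹
  have hwe : w * e = complexToPlane.symm v :=
    inv_mul_cancel_right₀ (Complex.exp_ne_zero _) _
  have hw : ‖w - s‖ < s * Real.sin (Real.pi / m) := by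
    have hnorm : ‖w - s‖ = dist v (s • coneAxis m k) := by
      rw [← mul_one ‖w - s‖, ← Complex.norm_exp_ofReal_mul_I (coneAngle m k), ← norm_mul, sub_mul,
        hwe, ← Complex.real_smul, ← LinearIsometryEquiv.norm_map complexToPlane, map_sub, map_smul,
        LinearIsometryEquiv.apply_symm_apply, dist_eq_norm, coneAxis]
    rwa [hnorm]
  have hw0 : w ≠ 0 := fun h0 => by
    simpa [h0] using re_pos_of_norm_sub_lt hδ₀ (by linarith [Real.pi_pos]) hw
  rw [← complexToPlane.apply_symm_apply v, ← hwe]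
  exact complexToPlane_mem_cone hw0 (abs_arg_lt_of_norm_sub_lt hδ₀ hδ hw)

/-- The disc inscribed in the `k`-th cone with centre at distance `ρ / 2` from the vertex, with
radius reduced by `d`. It is empty if `ρ ≤ 0 ≤ d`. -/
def innerBall (m : ℕ) (k : Fin m) (ρ d : ℝ) : Set Plane :=
  Metric.ball ((ρ / 2) • coneAxis m k) (ρ / 2 * Real.sin (Real.pi / m) - d)

theorem measurableSet_innerBall {m : ℕ} {k : Fin m} {ρ d : ℝ} :
    MeasurableSet (innerBall m k ρ d) :=
  measurableSet_ball

theorem isBounded_innerBall {m : ℕ} {k : Fin m} {ρ d : ℝ} :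
    Bornology.IsBounded (innerBall m k ρ d) :=
  Metric.isBounded_ball

theorem volume_real_innerBall (m : ℕ) (k : Fin m) (ρ d : ℝ) :
    volume.real (innerBall m k ρ d) =
      Real.pi * max (ρ / 2 * Real.sin (Real.pi / m) - d) 0 ^ 2 := by
  rw [Measure.real, innerBall, EuclideanSpace.volume_ball_fin_two, ENNReal.toReal_mul,
    ENNReal.toReal_pow, ENNReal.toReal_ofReal Real.pi_pos.le, ENNReal.toReal_ofReal', mul_comm]

theorem innerBall_zero_subset_cone {m : ℕ} (hm : 2 < m) (k : Fin m) (ρ : ℝ) :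
    innerBall m k ρ 0 ⊆ cone m k := by
  rw [innerBall, sub_zero]
  exact ball_subset_cone hm k _

theorem sub_mem_innerBall_zero {m : ℕ} {k : Fin m} {ρ d : ℝ} {z w : Plane}
    (hz : z ∈ innerBall m k ρ d) (hw : ‖w‖ ≤ d) : z - w ∈ innerBall m k ρ 0 := by
  rw [innerBall, Metric.mem_ball, dist_eq_norm] at hz ⊢
  rw [sub_right_comm]
  exact (norm_sub_le _ _).trans_lt (by linarith)

theorem norm_lt_of_mem_innerBall_zero {m : ℕ} {k : Fin m} {ρ : ℝ} {v : Plane}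
    (hv : v ∈ innerBall m k ρ 0) : ‖v‖ < ρ := by
  rw [innerBall, sub_zero, Metric.mem_ball, dist_eq_norm] at hv
  have hm : (1 : ℝ) ≤ m := by exact_mod_cast k.pos
  have hsin : 0 ≤ Real.sin (Real.pi / m) := Real.sin_nonneg_of_nonneg_of_le_pi
    (by positivity) (div_le_self Real.pi_pos.le hm)
  have hρ : 0 ≤ ρ / 2 := (pos_of_mul_pos_left ((norm_nonneg _).trans_lt hv) hsin).le
  have hcenter : ‖(ρ / 2) • coneAxis m k‖ = ρ / 2 := by
    rw [norm_smul, norm_coneAxis, mul_one, Real.norm_of_nonneg hρ]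
  have htriangle := norm_le_norm_add_norm_sub' v ((ρ / 2) • coneAxis m k)
  have hradius := mul_le_of_le_one_right hρ (Real.sin_le_one (Real.pi / m))
  linarith

end Cones

section PathLoss

theorem measurable_pathLoss (α : ℝ) : Measurable (pathLoss α) := by
  unfold pathLoss
  fun_prop

theorem pathLoss_le_one (α r : ℝ) : pathLoss α r ≤ 1 := min_le_right _ _

theorem pathLoss_nonneg (α : ℝ) {r : ℝ} (hr : 0 ≤ r) : 0 ≤ pathLoss α r :=
  le_min (Real.rpow_nonneg hr _) zero_le_one

theorem pathLoss_zero {α : ℝ} (hα : α ≠ 0) : pathLoss α 0 = 0 := by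
  rw [pathLoss, Real.zero_rpow (neg_ne_zero.mpr hα), min_eq_left zero_le_one]

/-- The cell of a point of the plane in the integer lattice. -/
noncomputable def latticeCell (v : Plane) : Fin 2 → ℤ := fun i => ⌊v i⌋

theorem measurable_latticeCell : Measurable latticeCell :=
  measurable_pi_iff.mpr fun i => Int.measurable_floor.comp
    ((measurable_pi_apply i).comp (PiLp.continuous_ofLp 2 _).measurable)

theorem norm_latticeCell_sub_latticeCell_le (v w : Plane) :
    ‖latticeCell v - latticeCell w‖ ≤ ‖v - w‖ + 1 := by
  refine (pi_norm_le_iff_of_nonneg (by positivity)).mpr fun i => ?_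
  obtain ⟨hlower, hupper⟩ := abs_le.mp (PiLp.norm_apply_le (v - w) i)
  simp only [PiLp.sub_apply] at hlower hupper
  rw [Int.norm_eq_abs, Pi.sub_apply, latticeCell, latticeCell, Int.cast_sub, abs_le]
  constructor <;>
    linarith [Int.floor_le (v i), Int.lt_floor_add_one (v i), Int.floor_le (w i),
      Int.lt_floor_add_one (w i)]

theorem norm_latticeCell_le (v : Plane) : ‖latticeCell v‖ ≤ ‖v‖ + 1 := by
  have h := norm_latticeCell_sub_latticeCell_le v 0
  have h0 : latticeCell 0 = 0 := by
    ext i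
    simp [latticeCell]
  rwa [h0, sub_zero, sub_zero] at h

theorem norm_le_two_mul_norm_latticeCell (v : Plane) : ‖v‖ ≤ 2 * (‖latticeCell v‖ + 1) := by
  have hi : ∀ i, ‖v i‖ ≤ ‖latticeCell v‖ + 1 := fun i => by
    have hcell : |(⌊v i⌋ : ℝ)| ≤ ‖latticeCell v‖ := norm_le_pi_norm (latticeCell v) i
    have hfract : |Int.fract (v i)| ≤ 1 := by
      rw [Int.abs_fract]
      exact (Int.fract_lt_one _).le
    calc ‖v i‖ = |(⌊v i⌋ : ℝ) + Int.fract (v i)| := by rw [Int.floor_add_fract, Real.norm_eq_abs]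
      _ ≤ ‖latticeCell v‖ + 1 := (abs_add_le _ _).trans (add_le_add hcell hfract)
  refine abs_le_of_sq_le_sq' ?_ (by positivity) |>.2
  rw [EuclideanSpace.norm_sq_eq, Fin.sum_univ_two]
  nlinarith [pow_le_pow_left₀ (norm_nonneg _) (hi 0) 2, pow_le_pow_left₀ (norm_nonneg _) (hi 1) 2]

theorem abs_floor_sub_sub_floor_le_one (a : ℝ) {b : ℝ} (hb : b ∈ Set.Ico 0 1) :
    |⌊a - b⌋ - ⌊a⌋| ≤ 1 := by
  have hupper : ⌊a - b⌋ ≤ ⌊a⌋ := Int.floor_le_floor (by linarith [hb.1])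
  have hlower : ⌊a⌋ - 1 ≤ ⌊a - b⌋ := by
    rw [← Int.floor_sub_one]
    exact Int.floor_le_floor (by linarith [hb.2])
  exact abs_le.mpr ⟨by lia, by lia⟩

theorem norm_latticeCell_sub_sub_le_one {w : Plane} (hw : latticeCell w = 0) (z : Plane) :
    ‖latticeCell (z - w) - latticeCell z‖ ≤ 1 := by
  refine (pi_norm_le_iff_of_nonneg zero_le_one).mpr fun i => ?_
  rw [Int.norm_eq_abs]
  exact_mod_cast abs_floor_sub_sub_floor_le_one (z i) (Int.floor_eq_zero_iff.mp (congrFun hw i))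

/-- Power decay on the integer lattice. -/
noncomputable def latticeDecay (α : ℝ) (i : Fin 2 → ℤ) : ℝ := (1 + ‖i‖) ^ (-α)

theorem latticeDecay_nonneg (α : ℝ) (i : Fin 2 → ℤ) : 0 ≤ latticeDecay α i := by
  unfold latticeDecay
  positivity

theorem latticeDecay_le_one {α : ℝ} (hα : 0 ≤ α) (i : Fin 2 → ℤ) : latticeDecay α i ≤ 1 :=
  Real.rpow_le_one_of_one_le_of_nonpos (by linarith [norm_nonneg i]) (by linarith)

theorem summable_latticeDecay {α : ℝ} (hα : 2 < α) : Summable (latticeDecay α) := by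
  refine (EisensteinSeries.summable_one_div_norm_rpow hα).of_norm_bounded_eventually ?_
  filter_upwards [(Set.finite_singleton (0 : Fin 2 → ℤ)).compl_mem_cofinite] with i hi
  rw [Real.norm_of_nonneg (latticeDecay_nonneg _ _)]
  exact Real.rpow_le_rpow_of_nonpos (norm_pos_iff.mpr hi) (by linarith) (by linarith)

theorem rpow_neg_le_mul_of_le_mul {α a b c : ℝ} (hα : 0 ≤ α) (ha : 0 < a) (hb : 0 < b)
    (hc : 0 < c) (h : b ≤ c * a) : a ^ (-α) ≤ c ^ α * b ^ (-α) := by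
  calc a ^ (-α) = c ^ α * (c * a) ^ (-α) := by
        rw [Real.mul_rpow hc.le ha.le, ← mul_assoc, ← Real.rpow_add hc, add_neg_cancel,
          Real.rpow_zero, one_mul]
    _ ≤ c ^ α * b ^ (-α) := mul_le_mul_of_nonneg_left
        (Real.rpow_le_rpow_of_nonpos hb h (neg_nonpos.mpr hα)) (by positivity)

theorem latticeDecay_le_of_norm_sub_le_one {α : ℝ} (hα : 0 ≤ α) {i j : Fin 2 → ℤ}
    (h : ‖i - j‖ ≤ 1) : latticeDecay α i ≤ 2 ^ α * latticeDecay α j := by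
  refine rpow_neg_le_mul_of_le_mul hα (by positivity) (by positivity) two_pos ?_
  linarith [norm_le_norm_add_norm_sub i j, norm_nonneg i]

theorem pathLoss_dist_le_latticeDecay {α : ℝ} (hα : 0 < α) (v w : Plane) :
    pathLoss α (dist v w) ≤ 4 ^ α * latticeDecay α (latticeCell v - latticeCell w) := by
  have hcell : ‖latticeCell v - latticeCell w‖ ≤ dist v w + 1 := by
    rw [dist_eq_norm]
    exact norm_latticeCell_sub_latticeCell_le v w
  rcases eq_or_ne v w with rfl | hne
  · rw [dist_self, pathLoss_zero hα.ne']
    exact mul_nonneg (by positivity) (latticeDecay_nonneg _ _)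
  rcases le_total 1 (dist v w) with hfar | hclose
  · exact (min_le_left _ _).trans (rpow_neg_le_mul_of_le_mul hα.le (dist_pos.mpr hne)
      (by positivity) (by norm_num) (by linarith))
  · calc pathLoss α (dist v w) ≤ 1 ^ (-α) := (min_le_right _ _).trans_eq (Real.one_rpow _).symm
      _ ≤ 4 ^ α * latticeDecay α (latticeCell v - latticeCell w) :=
        rpow_neg_le_mul_of_le_mul hα.le one_pos (by positivity) (by norm_num) (by linarith)

theorem inv_pathLoss_norm_le {α : ℝ} (hα : 0 ≤ α) {v : Plane} (hv : v ≠ 0) :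
    (pathLoss α ‖v‖)⁻¹ ≤ (2 * (‖latticeCell v‖ + 1)) ^ α := by
  have hcell := norm_nonneg (latticeCell v)
  refine inv_le_of_inv_le₀ (by positivity) ?_
  rw [← Real.rpow_neg (by positivity)]
  refine le_min ?_ (Real.rpow_le_one_of_one_le_of_nonpos (by linarith) (by linarith))
  exact Real.rpow_le_rpow_of_nonpos (norm_pos_iff.mpr hv) (norm_le_two_mul_norm_latticeCell v)
    (by linarith)

end PathLoss

/-! ### Measurability of the network -/

namespace Network

variable {Ω : Type*} {m : ℕ} {S : Network Ω m} (p : SINRParams) {t : ℕ}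

theorem measurableSet_isNearest [MeasurableSpace Ω] (hpos : ∀ i, Measurable (S.pos i))
    (hdest : ∀ i, Measurable (S.dest t i)) (i j : ℕ) :
    MeasurableSet {ω | S.IsNearest t i j ω} := by
  have hcone : ∀ k, MeasurableSet {ω | S.pos k ω - S.pos i ω ∈ cone m (S.dest t i ω)} := by
    intro k
    have : {ω | S.pos k ω - S.pos i ω ∈ cone m (S.dest t i ω)} =
        ⋃ d : Fin m, {ω | S.dest t i ω = d} ∩ (fun ω => S.pos k ω - S.pos i ω) ⁻¹' cone m d := by
      ext ω
      simp
    rw [this]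
    exact MeasurableSet.iUnion fun d => (hdest i (measurableSet_singleton d)).inter
      (((hpos k).sub (hpos i)) (measurableSet_cone m d))
  have hdist : ∀ k, MeasurableSet
      {ω | dist (S.pos i ω) (S.pos j ω) ≤ dist (S.pos i ω) (S.pos k ω)} := fun k =>
    measurableSet_le ((hpos i).dist (hpos j)) ((hpos i).dist (hpos k))
  have : {ω | S.IsNearest t i j ω} = {_ω | j ≠ i} ∩
      ({ω | S.pos j ω - S.pos i ω ∈ cone m (S.dest t i ω)} ∩ ⋂ (k : ℕ) (_ : k ≠ i),
        {ω | S.pos k ω - S.pos i ω ∈ cone m (S.dest t i ω)}ᶜ ∪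
        {ω | dist (S.pos i ω) (S.pos j ω) ≤ dist (S.pos i ω) (S.pos k ω)}) := by
    ext ω
    simp [IsNearest, imp_iff_not_or]
  rw [this]
  exact (MeasurableSet.const _).inter ((hcone j).inter
    (MeasurableSet.iInter fun k => MeasurableSet.iInter fun _ => (hcone k).compl.union (hdist k)))

theorem measurable_nn [MeasurableSpace Ω] (hpos : ∀ i, Measurable (S.pos i))
    (hdest : ∀ i, Measurable (S.dest t i)) (i : ℕ) : Measurable (S.nn t i) :=
  measurable_sInf_nat fun j => measurableSet_isNearest hpos hdest i j

theorem measurable_loss [MeasurableSpace Ω] (hpos : ∀ i, Measurable (S.pos i)) (i j : ℕ) :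
    Measurable (S.loss p i j) :=
  (measurable_pathLoss _).comp ((hpos i).dist (hpos j))

theorem measurable_loss_nn [MeasurableSpace Ω] (hpos : ∀ i, Measurable (S.pos i))
    (hdest : ∀ i, Measurable (S.dest t i)) (i : ℕ) :
    Measurable fun ω => S.loss p i (S.nn t i ω) ω :=
  measurable_apply_of_countable (measurable_loss p hpos i) (measurable_nn hpos hdest i)

theorem measurable_power [MeasurableSpace Ω] (hpos : ∀ i, Measurable (S.pos i))
    (hdest : ∀ i, Measurable (S.dest t i)) (i : ℕ) : Measurable (S.power p t i) :=
  (measurable_loss_nn p hpos hdest i).inv.const_mul _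

theorem measurable_txProb [MeasurableSpace Ω] (hpos : ∀ i, Measurable (S.pos i))
    (hdest : ∀ i, Measurable (S.dest t i)) (i : ℕ) : Measurable (S.txProb p t i) :=
  (measurable_power p hpos hdest i).inv.const_mul _

theorem measurable_receivedPower [MeasurableSpace Ω] (hpos : ∀ i, Measurable (S.pos i))
    (hdest : ∀ i, Measurable (S.dest t i)) (hfade : ∀ i j, Measurable (S.fade t i j)) (i j : ℕ) :
    Measurable fun ω =>
      ENNReal.ofReal (S.power p t i ω * S.fade t i j ω * S.loss p i j ω) :=
  (((measurable_power p hpos hdest i).mul (hfade i j)).mul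
    (measurable_loss p hpos i j)).ennreal_ofReal

theorem measurable_interferenceTerm [MeasurableSpace Ω] (hpos : ∀ i, Measurable (S.pos i))
    (hdest : ∀ i, Measurable (S.dest t i)) (hon : ∀ i, Measurable (S.isOn t i))
    (hfade : ∀ i j, Measurable (S.fade t i j)) (i j z : ℕ) :
    Measurable fun ω => if z ≠ i ∧ z ≠ j ∧ S.isOn t z ω = true then
      ENNReal.ofReal (S.power p t z ω * S.fade t z j ω * S.loss p z j ω) else 0 :=
  Measurable.ite ((MeasurableSet.const _).inter ((MeasurableSet.const _).inter
    (hon z (measurableSet_singleton true))))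
    (measurable_receivedPower p hpos hdest hfade z j) measurable_const

theorem measurable_interference [MeasurableSpace Ω] (hpos : ∀ i, Measurable (S.pos i))
    (hdest : ∀ i, Measurable (S.dest t i)) (hon : ∀ i, Measurable (S.isOn t i))
    (hfade : ∀ i j, Measurable (S.fade t i j)) (i j : ℕ) :
    Measurable (S.interference p t i j) :=
  Measurable.tsum fun z => measurable_interferenceTerm p hpos hdest hon hfade i j z

theorem measurable_sinr [MeasurableSpace Ω] (hpos : ∀ i, Measurable (S.pos i))
    (hdest : ∀ i, Measurable (S.dest t i)) (hon : ∀ i, Measurable (S.isOn t i))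
    (hfade : ∀ i j, Measurable (S.fade t i j)) (i j : ℕ) :
    Measurable (S.sinr p t i j) :=
  Measurable.ite
    ((hon i (measurableSet_singleton true)).inter (hon j (measurableSet_singleton false)))
    ((measurable_receivedPower p hpos hdest hfade i j).div
      (((measurable_interference p hpos hdest hon hfade i j).const_mul _).add_const _))
    measurable_const

/-- The event that node `i` transmits successfully to its nearest neighbour in slot `t`. -/
def success (S : Network Ω m) (p : SINRParams) (t i : ℕ) : Set Ω :=
  {ω | ENNReal.ofReal p.beta < S.sinr p t i (S.nn t i ω) ω}

theorem measurableSet_success [MeasurableSpace Ω] (hpos : ∀ i, Measurable (S.pos i))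
    (hdest : ∀ i, Measurable (S.dest t i)) (hon : ∀ i, Measurable (S.isOn t i))
    (hfade : ∀ i j, Measurable (S.fade t i j)) (i : ℕ) : MeasurableSet (S.success p t i) :=
  measurableSet_lt measurable_const (measurable_apply_of_countable
    (measurable_sinr p hpos hdest hon hfade i) (measurable_nn hpos hdest i))

theorem measurable_exitTime [MeasurableSpace Ω] (hpos : ∀ i, Measurable (S.pos i))
    (hdest : ∀ t i, Measurable (S.dest t i)) (hon : ∀ t i, Measurable (S.isOn t i))
    (hfade : ∀ t i j, Measurable (S.fade t i j)) (i : ℕ) : Measurable (S.exitTime p i) := by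
  classical
  unfold exitTime
  simp only [iInf_eq_if]
  exact Measurable.iInf fun t => Measurable.ite ((MeasurableSet.const _).inter
    (measurableSet_success p hpos (hdest t) (hon t) (hfade t) i)) measurable_const measurable_const

section History

variable (S)

theorem measurable_pos_history (t i : ℕ) : Measurable[S.history t] (S.pos i) :=
  Measurable.mono (comap_measurable _)
    ((le_iSup (fun i => MeasurableSpace.comap (S.pos i) inferInstance) i).trans
      (le_sup_left.trans (le_sup_left.trans le_sup_left))) le_rfl

theorem measurable_dest_history {s t : ℕ} (h : s ≤ t) (i : ℕ) :
    Measurable[S.history t] (S.dest s i) :=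
  Measurable.mono (comap_measurable _)
    ((le_iSup₂_of_le (f := fun s (_ : s ≤ t) => ⨆ i, MeasurableSpace.comap (S.dest s i) ⊤) s h
      (le_iSup (fun i => MeasurableSpace.comap (S.dest s i) ⊤) i)).trans
      (le_sup_right.trans (le_sup_left.trans le_sup_left))) le_rfl

theorem measurable_isOn_history {s t : ℕ} (h : s < t) (i : ℕ) :
    Measurable[S.history t] (S.isOn s i) :=
  Measurable.mono (comap_measurable _)
    ((le_iSup₂_of_le (f := fun s (_ : s < t) => ⨆ i, MeasurableSpace.comap (S.isOn s i) ⊤) s h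
      (le_iSup (fun i => MeasurableSpace.comap (S.isOn s i) ⊤) i)).trans
      (le_sup_right.trans le_sup_left)) le_rfl

theorem measurable_fade_history {s t : ℕ} (h : s < t) (i j : ℕ) :
    Measurable[S.history t] (S.fade s i j) :=
  Measurable.mono (comap_measurable _)
    ((le_iSup₂_of_le
      (f := fun s (_ : s < t) => ⨆ i, ⨆ j, MeasurableSpace.comap (S.fade s i j) inferInstance) s h
      (le_iSup_of_le i (le_iSup
        (fun j => MeasurableSpace.comap (S.fade s i j) inferInstance) j))).trans
      le_sup_right) le_rfl

theorem measurableSet_success_history {s t : ℕ} (h : s < t) (i : ℕ) :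
    MeasurableSet[S.history t] (S.success p s i) :=
  letI := S.history t
  measurableSet_success p (S.measurable_pos_history t) (S.measurable_dest_history h.le)
    (S.measurable_isOn_history h) (S.measurable_fade_history h) i

end History

end Network

theorem IsNetwork.history_le {Ω : Type*} [mΩ : MeasurableSpace Ω] {m : ℕ} {S : Network Ω m}
    {p : SINRParams} {Pr : Measure Ω} {Q : Measure PointConfig} {x : Plane}
    (h : IsNetwork S p Pr Q x) (t : ℕ) : S.history t ≤ mΩ := by
  refine sup_le (sup_le (sup_le ?_ ?_) ?_) ?_
  · exact iSup_le fun i => (h.measurable_pos i).comap_le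
  · exact iSup_le fun s => iSup_le fun _ => iSup_le fun i => (h.measurable_dest s i).comap_le
  · exact iSup_le fun s => iSup_le fun _ => iSup_le fun i => (h.measurable_isOn s i).comap_le
  · exact iSup_le fun s => iSup_le fun _ => iSup_le fun i => iSup_le fun j =>
      (h.measurable_fade s i j).comap_le

/-! ### One slot, conditionally on the history -/

theorem SINRParams.c_pos {p : SINRParams} (hM : 0 < p.avgPower) (he : p.eps < 1) : 0 < p.c :=
  mul_pos hM (inv_pos.mpr (sub_pos.mpr he))

namespace Network

variable {Ω : Type*} {m : ℕ} (S : Network Ω m) (p : SINRParams) (t : ℕ)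

theorem loss_nonneg (i j : ℕ) (ω : Ω) : 0 ≤ S.loss p i j ω := pathLoss_nonneg _ dist_nonneg

theorem loss_le_one (i j : ℕ) (ω : Ω) : S.loss p i j ω ≤ 1 := pathLoss_le_one _ _

variable {p}

theorem txProb_eq (hM : p.avgPower ≠ 0) (i : ℕ) (ω : Ω) :
    S.txProb p t i ω = (1 - p.eps) * S.loss p i (S.nn t i ω) ω := by
  rw [txProb, power, SINRParams.c]
  field_simp

theorem txProb_nonneg (hM : p.avgPower ≠ 0) (he : p.eps ≤ 1) (i : ℕ) (ω : Ω) :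
    0 ≤ S.txProb p t i ω := by
  rw [S.txProb_eq t hM]
  exact mul_nonneg (sub_nonneg.mpr he) (S.loss_nonneg p _ _ _)

theorem txProb_le (hM : p.avgPower ≠ 0) (he : p.eps ≤ 1) (i : ℕ) (ω : Ω) :
    S.txProb p t i ω ≤ 1 - p.eps := by
  rw [S.txProb_eq t hM]
  exact mul_le_of_le_one_right (sub_nonneg.mpr he) (S.loss_le_one p _ _ _)

theorem power_nonneg (hM : 0 ≤ p.avgPower) (he : p.eps ≤ 1) (i : ℕ) (ω : Ω) :
    0 ≤ S.power p t i ω :=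
  mul_nonneg (mul_nonneg hM (inv_nonneg.mpr (sub_nonneg.mpr he)))
    (inv_nonneg.mpr (S.loss_nonneg p _ _ _))

theorem power_mul_txProb_le (hM : 0 ≤ p.avgPower) (i : ℕ) (ω : Ω) :
    S.power p t i ω * S.txProb p t i ω ≤ p.avgPower := by
  rw [txProb, mul_left_comm]
  exact mul_le_of_le_one_right hM mul_inv_le_one

/-- The event that the nodes in `I` have the on/off states `b` and the fading powers indexed by
`J` lie in the sets `A`. -/
def slotEvent (t : ℕ) (I : Finset ℕ) (b : ℕ → Bool) (J : Finset (ℕ × ℕ)) (A : ℕ × ℕ → Set ℝ) :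
    Set Ω :=
  {ω | (∀ i ∈ I, S.isOn t i ω = b i) ∧ ∀ q ∈ J, S.fade t q.1 q.2 ω ∈ A q}

/-- The conditional probability of `slotEvent` given the history. -/
noncomputable def slotProb (p : SINRParams) (t : ℕ) (I : Finset ℕ) (b : ℕ → Bool)
    (J : Finset (ℕ × ℕ)) (A : ℕ × ℕ → Set ℝ) (ω : Ω) : ℝ≥0∞ :=
  ENNReal.ofReal (∏ i ∈ I, if b i = true then S.txProb p t i ω else 1 - S.txProb p t i ω) *
    ∏ q ∈ J, expMeasure p.mu (A q)

theorem slotEvent_insert_isOn {I : Finset ℕ} {b : ℕ → Bool} {z : ℕ} (hbz : b z = true)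
    (J : Finset (ℕ × ℕ)) (A : ℕ × ℕ → Set ℝ) :
    S.slotEvent t (insert z I) b J A = S.slotEvent t I b J A ∩ {ω | S.isOn t z ω = true} := by
  ext ω
  simp only [slotEvent, Finset.forall_mem_insert, hbz, Set.mem_inter_iff, Set.mem_ofPred_eq]
  tauto

theorem slotEvent_insert_fade (I : Finset ℕ) (b : ℕ → Bool) {J : Finset (ℕ × ℕ)}
    (A : ℕ × ℕ → Set ℝ) {q : ℕ × ℕ} (hq : q ∉ J) (B : Set ℝ) :
    S.slotEvent t I b (insert q J) (Function.update A q B) =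
      S.slotEvent t I b J A ∩ S.fade t q.1 q.2 ⁻¹' B := by
  ext ω
  have hA : ∀ r ∈ J, Function.update A q B r = A r := fun r hr =>
    Function.update_of_ne (ne_of_mem_of_not_mem hr hq) _ _
  have hJ : (∀ r ∈ J, S.fade t r.1 r.2 ω ∈ Function.update A q B r) ↔
      ∀ r ∈ J, S.fade t r.1 r.2 ω ∈ A r := forall₂_congr fun r hr => by rw [hA r hr]
  simp only [slotEvent, Finset.forall_mem_insert, Function.update_self, hJ, Set.mem_inter_iff,
    Set.mem_preimage, Set.mem_ofPred_eq]
  tauto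

theorem slotProb_insert_isOn (hM : p.avgPower ≠ 0) (he : p.eps ≤ 1) {I : Finset ℕ}
    {b : ℕ → Bool} {z : ℕ} (hz : z ∉ I) (hbz : b z = true) (J : Finset (ℕ × ℕ))
    (A : ℕ × ℕ → Set ℝ) (ω : Ω) :
    S.slotProb p t (insert z I) b J A ω =
      ENNReal.ofReal (S.txProb p t z ω) * S.slotProb p t I b J A ω := by
  rw [slotProb, slotProb, Finset.prod_insert hz, if_pos hbz,
    ENNReal.ofReal_mul (S.txProb_nonneg t hM he z ω), mul_assoc]

theorem slotProb_insert_fade (I : Finset ℕ) (b : ℕ → Bool) {J : Finset (ℕ × ℕ)}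
    (A : ℕ × ℕ → Set ℝ) {q : ℕ × ℕ} (hq : q ∉ J) (B : Set ℝ) (ω : Ω) :
    S.slotProb p t I b (insert q J) (Function.update A q B) ω =
      S.slotProb p t I b J A ω * expMeasure p.mu B := by
  have hA : ∀ r ∈ J, expMeasure p.mu (Function.update A q B r) = expMeasure p.mu (A r) :=
    fun r hr => by rw [Function.update_of_ne (ne_of_mem_of_not_mem hr hq)]
  rw [slotProb, slotProb, Finset.prod_insert hq, Function.update_self, Finset.prod_congr rfl hA]
  ring

theorem measurable_slotProb_history (I : Finset ℕ) (b : ℕ → Bool) (J : Finset (ℕ × ℕ))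
    (A : ℕ × ℕ → Set ℝ) : Measurable[S.history t] (S.slotProb p t I b J A) := by
  let _ := S.history t
  have htx : ∀ i, Measurable (S.txProb p t i) :=
    measurable_txProb p (S.measurable_pos_history t) (S.measurable_dest_history le_rfl)
  refine (Measurable.ennreal_ofReal (Finset.measurable_fun_prod _ fun i _ => ?_)).mul_const _
  split_ifs
  · exact htx i
  · exact (htx i).const_sub 1

end Network

namespace IsNetwork

variable {Ω : Type*} [mΩ : MeasurableSpace Ω] {m : ℕ} {S : Network Ω m} {p : SINRParams}
  {Pr : Measure Ω} {Q : Measure PointConfig} {x : Plane}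

theorem measurableSet_slotEvent (h : IsNetwork S p Pr Q x) (t : ℕ) (I : Finset ℕ) (b : ℕ → Bool)
    (J : Finset (ℕ × ℕ)) {A : ℕ × ℕ → Set ℝ} (hA : ∀ q, MeasurableSet (A q)) :
    MeasurableSet (S.slotEvent t I b J A) := by
  have : S.slotEvent t I b J A = (⋂ i ∈ I, S.isOn t i ⁻¹' {b i}) ∩
      ⋂ q ∈ J, S.fade t q.1 q.2 ⁻¹' A q := by
    ext ω
    simp [Network.slotEvent]
  rw [this]
  exact (MeasurableSet.biInter I.countable_toSet fun i _ =>
    h.measurable_isOn t i (measurableSet_singleton _)).inter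
    (MeasurableSet.biInter J.countable_toSet fun q _ => h.measurable_fade t q.1 q.2 (hA q))

variable [IsFiniteMeasure Pr]

theorem measure_inter_slotEvent (h : IsNetwork S p Pr Q x) (hμ : 0 < p.mu)
    (hM : p.avgPower ≠ 0) (he0 : 0 ≤ p.eps) (he : p.eps ≤ 1) (t : ℕ)
    (I : Finset ℕ) (b : ℕ → Bool) (J : Finset (ℕ × ℕ)) {A : ℕ × ℕ → Set ℝ}
    (hA : ∀ q, MeasurableSet (A q)) {H : Set Ω} (hH : MeasurableSet[S.history t] H) :
    Pr (H ∩ S.slotEvent t I b J A) = ∫⁻ ω in H, S.slotProb p t I b J A ω ∂Pr := by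
  have := isProbabilityMeasure_expMeasure hμ
  have hE := h.measurableSet_slotEvent t I b J hA
  have hle := h.history_le t
  let R : Ω → ℝ := fun ω =>
    (∏ i ∈ I, if b i = true then S.txProb p t i ω else 1 - S.txProb p t i ω) *
      ∏ q ∈ J, (expMeasure p.mu).real (A q)
  have hR : Pr⟦S.slotEvent t I b J A | S.history t⟧ =ᵐ[Pr] R := h.cond_law t I b J A hA
  have hprod0 : ∀ ω, 0 ≤ ∏ i ∈ I, if b i = true then S.txProb p t i ω else 1 - S.txProb p t i ω :=
    fun ω => Finset.prod_nonneg fun i _ => by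
      have h0 := S.txProb_nonneg t hM he i ω
      have h1 := S.txProb_le t hM he i ω
      split_ifs <;> linarith
  have hR0 : ∀ ω, 0 ≤ R ω := fun ω =>
    mul_nonneg (hprod0 ω) (Finset.prod_nonneg fun _ _ => measureReal_nonneg)
  have hint : ∫ ω in H, R ω ∂Pr = Pr.real (H ∩ S.slotEvent t I b J A) := by
    rw [← setIntegral_congr_ae₀ (hle _ hH).nullMeasurableSet (hR.mono fun ω hω _ => hω),
      setIntegral_condExp hle ((integrable_const _).indicator hE) hH, setIntegral_indicator hE]
    simp
  rw [← ofReal_measureReal, ← hint, ofReal_integral_eq_lintegral_ofReal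
    (integrable_condExp.congr hR).integrableOn (ae_of_all _ hR0)]
  refine lintegral_congr fun ω => ?_
  rw [ENNReal.ofReal_mul (hprod0 ω), ENNReal.ofReal_prod_of_nonneg fun _ _ => measureReal_nonneg,
    Network.slotProb, Finset.prod_congr rfl fun _ _ => ofReal_measureReal]

theorem setLIntegral_slotEvent (h : IsNetwork S p Pr Q x) (hμ : 0 < p.mu)
    (hM : p.avgPower ≠ 0) (he0 : 0 ≤ p.eps) (he : p.eps ≤ 1) (t : ℕ)
    (I : Finset ℕ) (b : ℕ → Bool) (J : Finset (ℕ × ℕ)) {A : ℕ × ℕ → Set ℝ}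
    (hA : ∀ q, MeasurableSet (A q)) {f : Ω → ℝ≥0∞} (hf : Measurable[S.history t] f)
    {H : Set Ω} (hH : MeasurableSet[S.history t] H) :
    ∫⁻ ω in H ∩ S.slotEvent t I b J A, f ω ∂Pr =
      ∫⁻ ω in H, f ω * S.slotProb p t I b J A ω ∂Pr :=
  setLIntegral_inter_eq_setLIntegral_mul (h.history_le t)
    (S.measurable_slotProb_history t I b J A)
    (fun _ hH => h.measure_inter_slotEvent hμ hM he0 he t I b J hA hH) hf hH

theorem setLIntegral_slotEvent_mul_fade (h : IsNetwork S p Pr Q x) (hμ : 0 < p.mu)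
    (hM : p.avgPower ≠ 0) (he0 : 0 ≤ p.eps) (he : p.eps ≤ 1) (t : ℕ)
    (I : Finset ℕ) (b : ℕ → Bool) {J : Finset (ℕ × ℕ)} {A : ℕ × ℕ → Set ℝ}
    (hA : ∀ q, MeasurableSet (A q)) {q : ℕ × ℕ} (hq : q ∉ J)
    {f : Ω → ℝ≥0∞} (hf : Measurable[S.history t] f)
    {H : Set Ω} (hH : MeasurableSet[S.history t] H) :
    ∫⁻ ω in H ∩ S.slotEvent t I b J A, f ω * ENNReal.ofReal (S.fade t q.1 q.2 ω) ∂Pr =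
      (∫⁻ ω in H, f ω * S.slotProb p t I b J A ω ∂Pr) * meanFade p.mu := by
  have hle := h.history_le t
  have hprob : Measurable fun ω => f ω * S.slotProb p t I b J A ω :=
    (hf.mul (S.measurable_slotProb_history t I b J A)).mono hle le_rfl
  refine setLIntegral_mul_comp_eq ((hle _ hH).inter (h.measurableSet_slotEvent t I b J hA))
    (h.measurable_fade t q.1 q.2) (hf.mono hle le_rfl) (fun B hB => ?_) ENNReal.measurable_ofReal
  have hupdate : ∀ r, MeasurableSet (Function.update A q B r) := fun r => by
    rcases eq_or_ne r q with rfl | hr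
    · rwa [Function.update_self]
    · rw [Function.update_of_ne hr]
      exact hA r
  rw [Set.inter_assoc, ← S.slotEvent_insert_fade t I b A hq B,
    h.setLIntegral_slotEvent hμ hM he0 he t I b _ hupdate hf hH,
    ← lintegral_mul_const _ hprob]
  simp only [S.slotProb_insert_fade t I b A hq B, mul_assoc]

end IsNetwork

namespace Network

variable {Ω : Type*} {m : ℕ} (S : Network Ω m) (p : SINRParams) (t n i j : ℕ)

/-- The event that in slot `t` node `i` transmits, node `j` listens, and the fading power from
`i` to `j` exceeds `n`. -/
def linkEvent : Set Ω :=
  S.slotEvent t {i, j} (fun k => decide (k ≠ j)) {(i, j)} fun _ => Set.Ioi (n : ℝ)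

/-- The conditional probability of `linkEvent` given the history. -/
noncomputable def linkProb (ω : Ω) : ℝ≥0∞ :=
  S.slotProb p t {i, j} (fun k => decide (k ≠ j)) {(i, j)} (fun _ => Set.Ioi (n : ℝ)) ω

/-- A bound for the conditional mean, given the history, of the interference at node `j` in any
slot: by power control every transmitter has mean power at most `M`. -/
noncomputable def meanInterference (ω : Ω) : ℝ≥0∞ :=
  ENNReal.ofReal p.avgPower * meanFade p.mu * ∑' z, ENNReal.ofReal (S.loss p z j ω)

theorem measurable_meanInterference [MeasurableSpace Ω] (hpos : ∀ i, Measurable (S.pos i))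
    (j : ℕ) : Measurable (S.meanInterference p j) :=
  (Measurable.tsum fun z => (measurable_loss p hpos z j).ennreal_ofReal).const_mul _

variable {p t n i j}

theorem mem_linkEvent (hij : i ≠ j) {ω : Ω} : ω ∈ S.linkEvent t n i j ↔
    S.isOn t i ω = true ∧ S.isOn t j ω = false ∧ (n : ℝ) < S.fade t i j ω := by
  simp [linkEvent, slotEvent, hij, and_assoc]

theorem linkProb_eq (hμ : 0 < p.mu) (hij : i ≠ j) (ω : Ω) : S.linkProb p t n i j ω =
    ENNReal.ofReal (S.txProb p t i ω * (1 - S.txProb p t j ω)) *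
      ENNReal.ofReal (Real.exp (-(p.mu * n))) := by
  simp [linkProb, slotProb, Finset.prod_pair hij, hij, expMeasure_Ioi hμ n.cast_nonneg]

theorem ofReal_beta_lt_sinr (hβ : 0 < p.beta) (hc : 0 ≤ p.c) {ω : Ω} (hnn : S.nn t i ω = j)
    (hloss : S.loss p i j ω ≠ 0) (hon : S.isOn t i ω = true) (hoff : S.isOn t j ω = false)
    (hfade : n ≤ S.fade t i j ω)
    (hI : ENNReal.ofReal (p.beta * p.gamma) * S.interference p t i j ω <
      ENNReal.ofReal (p.c * n - p.beta * p.noise)) (hN : 0 ≤ p.noise) :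
    ENNReal.ofReal p.beta < S.sinr p t i j ω := by
  have hsignal : S.power p t i ω * S.fade t i j ω * S.loss p i j ω = p.c * S.fade t i j ω := by
    rw [power, hnn]
    field_simp
  rw [sinr, if_pos ⟨hon, hoff⟩, hsignal,
    ENNReal.lt_div_iff_mul_lt (Or.inr ENNReal.ofReal_ne_top)
      (Or.inr (ENNReal.ofReal_pos.mpr hβ).ne'), mul_add, ← mul_assoc, ← ENNReal.ofReal_mul hβ.le,
    ← ENNReal.ofReal_mul hβ.le]
  rw [ENNReal.ofReal_sub _ (mul_nonneg hβ.le hN)] at hI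
  exact (lt_tsub_iff_right.mp hI).trans_le
    (ENNReal.ofReal_le_ofReal (mul_le_mul_of_nonneg_left hfade hc))

end Network

namespace IsNetwork

variable {Ω : Type*} [mΩ : MeasurableSpace Ω] {m : ℕ} {S : Network Ω m} {p : SINRParams}
  {Pr : Measure Ω} {Q : Measure PointConfig} {x : Plane} [IsFiniteMeasure Pr]

theorem measure_inter_linkEvent (h : IsNetwork S p Pr Q x) (hμ : 0 < p.mu)
    (hM : p.avgPower ≠ 0) (he0 : 0 ≤ p.eps) (he : p.eps ≤ 1) (t n i j : ℕ)
    {H : Set Ω} (hH : MeasurableSet[S.history t] H) :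
    Pr (H ∩ S.linkEvent t n i j) = ∫⁻ ω in H, S.linkProb p t n i j ω ∂Pr :=
  h.measure_inter_slotEvent hμ hM he0 he t _ _ _ (fun _ => measurableSet_Ioi) hH

theorem setLIntegral_slotEvent_receivedPower_le (h : IsNetwork S p Pr Q x) (hμ : 0 < p.mu)
    (hM : 0 < p.avgPower) (he0 : 0 ≤ p.eps) (he : p.eps ≤ 1) (t j : ℕ) {I : Finset ℕ}
    {b : ℕ → Bool} {J : Finset (ℕ × ℕ)} {A : ℕ × ℕ → Set ℝ} (hA : ∀ q, MeasurableSet (A q))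
    {z : ℕ} (hz : z ∉ I) (hbz : b z = true) (hzj : (z, j) ∉ J)
    {H : Set Ω} (hH : MeasurableSet[S.history t] H) :
    ∫⁻ ω in H ∩ S.slotEvent t (insert z I) b J A,
        ENNReal.ofReal (S.power p t z ω * S.fade t z j ω * S.loss p z j ω) ∂Pr ≤
      ∫⁻ ω in H, ENNReal.ofReal p.avgPower * meanFade p.mu * ENNReal.ofReal (S.loss p z j ω) *
        S.slotProb p t I b J A ω ∂Pr := by
  let f : Ω → ℝ≥0∞ := fun ω =>
    ENNReal.ofReal (S.power p t z ω) * ENNReal.ofReal (S.loss p z j ω)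
  have hf : Measurable[S.history t] f := by
    let _ := S.history t
    exact (Network.measurable_power p (S.measurable_pos_history t)
      (S.measurable_dest_history le_rfl) z).ennreal_ofReal.mul
      (Network.measurable_loss p (S.measurable_pos_history t) z j).ennreal_ofReal
  have hpower : ∀ ω, ENNReal.ofReal (S.power p t z ω) * ENNReal.ofReal (S.txProb p t z ω) ≤
      ENNReal.ofReal p.avgPower := fun ω => by
    rw [← ENNReal.ofReal_mul (S.power_nonneg t hM.le he z ω)]
    exact ENNReal.ofReal_le_ofReal (S.power_mul_txProb_le t hM.le z ω)
  calc _ = ∫⁻ ω in H ∩ S.slotEvent t (insert z I) b J A,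
        f ω * ENNReal.ofReal (S.fade t z j ω) ∂Pr := by
        refine lintegral_congr fun ω => ?_
        rw [ENNReal.ofReal_mul' (S.loss_nonneg p z j ω),
          ENNReal.ofReal_mul (S.power_nonneg t hM.le he z ω)]
        ring
    _ = (∫⁻ ω in H, f ω * S.slotProb p t (insert z I) b J A ω ∂Pr) * meanFade p.mu :=
        h.setLIntegral_slotEvent_mul_fade hμ hM.ne' he0 he t _ b hA hzj hf hH
    _ = ∫⁻ ω in H, f ω * S.slotProb p t (insert z I) b J A ω * meanFade p.mu ∂Pr :=
        (lintegral_mul_const' _ _ (meanFade_lt_top hμ).ne).symm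
    _ ≤ _ := by
        refine lintegral_mono fun ω => ?_
        rw [S.slotProb_insert_isOn t hM.ne' he hz hbz]
        calc _ = ENNReal.ofReal (S.power p t z ω) * ENNReal.ofReal (S.txProb p t z ω) *
              (meanFade p.mu * ENNReal.ofReal (S.loss p z j ω) * S.slotProb p t I b J A ω) := by
              ring
          _ ≤ ENNReal.ofReal p.avgPower *
              (meanFade p.mu * ENNReal.ofReal (S.loss p z j ω) * S.slotProb p t I b J A ω) :=
              mul_le_mul_left (hpower ω) _
          _ = _ := by ring

theorem setLIntegral_linkEvent_interferenceTerm_le (h : IsNetwork S p Pr Q x) (hμ : 0 < p.mu)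
    (hM : 0 < p.avgPower) (he0 : 0 ≤ p.eps) (he : p.eps ≤ 1) (t n i j z : ℕ)
    {H : Set Ω} (hH : MeasurableSet[S.history t] H) :
    ∫⁻ ω in H ∩ S.linkEvent t n i j, (if z ≠ i ∧ z ≠ j ∧ S.isOn t z ω = true then
        ENNReal.ofReal (S.power p t z ω * S.fade t z j ω * S.loss p z j ω) else 0) ∂Pr ≤
      ∫⁻ ω in H, ENNReal.ofReal p.avgPower * meanFade p.mu * ENNReal.ofReal (S.loss p z j ω) *
        S.linkProb p t n i j ω ∂Pr := by
  by_cases hz : z ≠ i ∧ z ≠ j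
  swap
  · have hoff : ∀ ω, ¬(z ≠ i ∧ z ≠ j ∧ S.isOn t z ω = true) := fun ω hω => hz ⟨hω.1, hω.2.1⟩
    simp only [hoff, if_false, lintegral_zero, zero_le]
  obtain ⟨hzi, hzj⟩ := hz
  have hon : MeasurableSet {ω | S.isOn t z ω = true} :=
    h.measurable_isOn t z (measurableSet_singleton true)
  calc _ = ∫⁻ ω in H ∩ S.linkEvent t n i j, {ω | S.isOn t z ω = true}.indicator (fun ω =>
        ENNReal.ofReal (S.power p t z ω * S.fade t z j ω * S.loss p z j ω)) ω ∂Pr := by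
        simp only [Set.indicator_apply, hzi, hzj, Set.mem_ofPred_eq, ne_eq, not_false_eq_true,
          true_and]
    _ = ∫⁻ ω in H ∩ S.slotEvent t (insert z {i, j}) (fun k => decide (k ≠ j)) {(i, j)}
          (fun _ => Set.Ioi (n : ℝ)),
        ENNReal.ofReal (S.power p t z ω * S.fade t z j ω * S.loss p z j ω) ∂Pr := by
        rw [setLIntegral_indicator hon, Set.inter_comm, Set.inter_assoc, Network.linkEvent,
          ← S.slotEvent_insert_isOn t (by simp [hzj])]
    _ ≤ _ := h.setLIntegral_slotEvent_receivedPower_le hμ hM he0 he t j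
        (fun _ => measurableSet_Ioi) (by simp [hzi, hzj]) (by simp [hzj]) (by simp [hzi]) hH

theorem setLIntegral_linkEvent_interference_le (h : IsNetwork S p Pr Q x) (hμ : 0 < p.mu)
    (hM : 0 < p.avgPower) (he0 : 0 ≤ p.eps) (he : p.eps ≤ 1) (t n i j : ℕ)
    {H : Set Ω} (hH : MeasurableSet[S.history t] H) :
    ∫⁻ ω in H ∩ S.linkEvent t n i j, S.interference p t i j ω ∂Pr ≤
      ∫⁻ ω in H, S.meanInterference p j ω * S.linkProb p t n i j ω ∂Pr := by
  have hlink : Measurable (S.linkProb p t n i j) :=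
    (S.measurable_slotProb_history t _ _ _ _).mono (h.history_le t) le_rfl
  have hterm : ∀ z, Measurable fun ω => ENNReal.ofReal p.avgPower * meanFade p.mu *
      ENNReal.ofReal (S.loss p z j ω) * S.linkProb p t n i j ω := fun z =>
    ((Network.measurable_loss p h.measurable_pos z j).ennreal_ofReal.const_mul _).mul hlink
  simp only [Network.interference, Network.meanInterference, ← ENNReal.tsum_mul_left,
    ← ENNReal.tsum_mul_right]
  rw [lintegral_tsum fun z => (Network.measurable_interferenceTerm p h.measurable_pos
      (h.measurable_dest t) (h.measurable_isOn t) (h.measurable_fade t) i j z).aemeasurable,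
    lintegral_tsum fun z => (hterm z).aemeasurable]
  exact ENNReal.tsum_le_tsum fun z =>
    h.setLIntegral_linkEvent_interferenceTerm_le hμ hM he0 he t n i j z hH

theorem half_measure_linkEvent_le_measure_success (h : IsNetwork S p Pr Q x) (hμ : 0 < p.mu)
    (hM : 0 < p.avgPower) (he0 : 0 ≤ p.eps) (he : p.eps < 1) (hβ : 0 < p.beta)
    (hN : 0 ≤ p.noise) {t n i j : ℕ} (hij : i ≠ j) {H : Set Ω}
    (hH : MeasurableSet[S.history t] H) (hnn : ∀ ω ∈ H, S.nn t i ω = j)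
    (hloss : ∀ ω ∈ H, S.loss p i j ω ≠ 0) (hn : p.beta * p.noise < p.c * n)
    (hmean : ∀ ω ∈ H, ENNReal.ofReal (p.beta * p.gamma) * S.meanInterference p j ω ≤
      ENNReal.ofReal (p.c * n - p.beta * p.noise) / 2) :
    Pr (H ∩ S.linkEvent t n i j) / 2 ≤ Pr (H ∩ S.success p t i) := by
  let R := ENNReal.ofReal (p.c * n - p.beta * p.noise)
  have hR0 : R ≠ 0 := (ENNReal.ofReal_pos.mpr (sub_pos.mpr hn)).ne'
  have hmeas := Network.measurable_interference p h.measurable_pos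
    (h.measurable_dest t) (h.measurable_isOn t) (h.measurable_fade t) i j
  have hint : ∫⁻ ω in H ∩ S.linkEvent t n i j,
      ENNReal.ofReal (p.beta * p.gamma) * S.interference p t i j ω ∂Pr ≤
      R / 2 * Pr (H ∩ S.linkEvent t n i j) := by
    rw [h.measure_inter_linkEvent hμ hM.ne' he0 he.le t n i j hH,
      lintegral_const_mul' _ _ ENNReal.ofReal_ne_top,
      ← lintegral_const_mul' _ _ (ENNReal.div_ne_top ENNReal.ofReal_ne_top two_ne_zero)]
    refine (mul_le_mul_right
      (h.setLIntegral_linkEvent_interference_le hμ hM he0 he.le t n i j hH) _).trans ?_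
    rw [← lintegral_const_mul' _ _ ENNReal.ofReal_ne_top]
    refine setLIntegral_mono' (h.history_le t _ hH) fun ω hω => ?_
    rw [← mul_assoc]
    exact mul_le_mul_left (hmean ω hω) _
  refine (half_measure_le_measure_inter_lt (measure_ne_top _ _) (hmeas.const_mul _) hR0
    ENNReal.ofReal_ne_top hint).trans (measure_mono ?_)
  rintro ω ⟨⟨hωH, hlink⟩, hI⟩
  obtain ⟨hon, hoff, hfade⟩ := (S.mem_linkEvent hij).mp hlink
  refine ⟨hωH, ?_⟩
  have := S.ofReal_beta_lt_sinr hβ (SINRParams.c_pos hM he).le (hnn ω hωH) (hloss ω hωH) hon hoff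
    hfade.le hI hN
  simpa only [Network.success, Set.mem_ofPred_eq, hnn ω hωH] using this

end IsNetwork

/-- The constant factor of `Network.invSuccessBound`. -/
noncomputable def SINRParams.successConst (p : SINRParams) : ℝ :=
  2 / ((1 - p.eps) * p.eps) * Real.exp (p.mu * (p.beta * p.noise / p.c + 1))

theorem SINRParams.successConst_pos {p : SINRParams} (he0 : 0 < p.eps) (he : p.eps < 1) :
    0 < p.successConst :=
  mul_pos (div_pos two_pos (mul_pos (sub_pos.mpr he) he0)) (Real.exp_pos _)

namespace Network

variable {Ω : Type*} {m : ℕ} {S : Network Ω m} (p : SINRParams) {t : ℕ}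

/-- A level such that a signal of node `i` whose fading power exceeds it survives, at the intended
receiver, an interference of twice its conditional mean. -/
noncomputable def fadeLevel (S : Network Ω m) (p : SINRParams) (t i : ℕ) (ω : Ω) : ℕ :=
  ⌊(p.beta * p.noise + 2 * (p.beta * p.gamma * (S.meanInterference p (S.nn t i ω) ω).toReal)) /
    p.c⌋₊ + 1

/-- A bound for the inverse of the conditional probability, given the history, that node `i`
succeeds in slot `t`. It is infinite if `nn t i = i`, the path loss being then `0 ^ (-α) = 0`. -/
noncomputable def invSuccessBound (S : Network Ω m) (p : SINRParams) (t i : ℕ) (ω : Ω) : ℝ≥0∞ :=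
  ENNReal.ofReal p.successConst * (ENNReal.ofReal (S.loss p i (S.nn t i ω) ω))⁻¹ *
    eexp (ENNReal.ofReal (2 * p.mu / p.c) *
      (ENNReal.ofReal (p.beta * p.gamma) * S.meanInterference p (S.nn t i ω) ω))

theorem measurable_meanInterference_nn [MeasurableSpace Ω] (hpos : ∀ i, Measurable (S.pos i))
    (hdest : ∀ i, Measurable (S.dest t i)) (i : ℕ) :
    Measurable fun ω => S.meanInterference p (S.nn t i ω) ω :=
  measurable_apply_of_countable (S.measurable_meanInterference p hpos)
    (measurable_nn hpos hdest i)

theorem measurable_fadeLevel [MeasurableSpace Ω] (hpos : ∀ i, Measurable (S.pos i))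
    (hdest : ∀ i, Measurable (S.dest t i)) (i : ℕ) : Measurable (S.fadeLevel p t i) :=
  (Nat.measurable_floor.comp (((((measurable_meanInterference_nn p hpos hdest
    i).ennreal_toReal.const_mul _).const_mul _).const_add _).div_const _)).add_const 1

theorem measurable_invSuccessBound [MeasurableSpace Ω] (hpos : ∀ i, Measurable (S.pos i))
    (hdest : ∀ i, Measurable (S.dest t i)) (i : ℕ) : Measurable (S.invSuccessBound p t i) :=
  ((measurable_loss_nn p hpos hdest i).ennreal_ofReal.inv.const_mul _).mul
    (continuous_eexp.measurable.comp
      (((measurable_meanInterference_nn p hpos hdest i).const_mul _).const_mul _))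

variable {p} {i : ℕ} {ω : Ω}

theorem beta_mul_noise_lt_c_mul_fadeLevel (hc : 0 < p.c) :
    p.beta * p.noise + 2 * (p.beta * p.gamma * (S.meanInterference p (S.nn t i ω) ω).toReal) <
      p.c * S.fadeLevel p t i ω := by
  have := Nat.lt_floor_add_one ((p.beta * p.noise +
    2 * (p.beta * p.gamma * (S.meanInterference p (S.nn t i ω) ω).toReal)) / p.c)
  rw [div_lt_iff₀' hc] at this
  simpa [fadeLevel] using this

theorem fadeLevel_le (hc : 0 ≤ p.c) (hβ : 0 ≤ p.beta) (hγ : 0 ≤ p.gamma) (hN : 0 ≤ p.noise) :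
    (S.fadeLevel p t i ω : ℝ) ≤ p.beta * p.noise / p.c + 1 +
      2 / p.c * (p.beta * p.gamma * (S.meanInterference p (S.nn t i ω) ω).toReal) := by
  rw [fadeLevel, Nat.cast_add_one]
  refine (add_le_add_left (Nat.floor_le (by positivity)) 1).trans_eq ?_
  ring

theorem loss_nn_pos_of_invSuccessBound_ne_top (he0 : 0 < p.eps) (he : p.eps < 1)
    (h : S.invSuccessBound p t i ω ≠ ∞) : 0 < S.loss p i (S.nn t i ω) ω := by
  refine (S.loss_nonneg p _ _ _).lt_of_ne' fun hloss => h ?_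
  rw [invSuccessBound, hloss, ENNReal.ofReal_zero, ENNReal.inv_zero,
    ENNReal.mul_top (ENNReal.ofReal_pos.mpr (p.successConst_pos he0 he)).ne',
    ENNReal.top_mul (zero_lt_one.trans_le (one_le_eexp _)).ne']

theorem nn_ne_of_loss_nn_pos (hα : p.alpha ≠ 0) (h : 0 < S.loss p i (S.nn t i ω) ω) :
    S.nn t i ω ≠ i := by
  intro hnn
  rw [hnn, loss, dist_self, pathLoss_zero hα] at h
  exact h.false

theorem meanInterference_nn_ne_top_of_invSuccessBound_ne_top (hμ : 0 < p.mu)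
    (hM : 0 < p.avgPower) (he0 : 0 < p.eps) (he : p.eps < 1)
    (h : S.invSuccessBound p t i ω ≠ ∞) :
    ENNReal.ofReal (p.beta * p.gamma) * S.meanInterference p (S.nn t i ω) ω ≠ ∞ := by
  refine fun htop => h ?_
  have hconst : ENNReal.ofReal (2 * p.mu / p.c) ≠ 0 :=
    (ENNReal.ofReal_pos.mpr (div_pos (mul_pos two_pos hμ) (SINRParams.c_pos hM he))).ne'
  rw [invSuccessBound, htop, ENNReal.mul_top hconst, eexp_top, ENNReal.mul_top]
  exact mul_ne_zero (ENNReal.ofReal_pos.mpr (p.successConst_pos he0 he)).ne'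
    (ENNReal.inv_ne_zero.mpr ENNReal.ofReal_ne_top)

theorem inv_invSuccessBound_eq (hμ : 0 < p.mu) (hM : 0 < p.avgPower) (he0 : 0 < p.eps)
    (he : p.eps < 1) (hβ : 0 ≤ p.beta) (hγ : 0 ≤ p.gamma)
    (h : S.invSuccessBound p t i ω ≠ ∞) : (S.invSuccessBound p t i ω)⁻¹ =
      ENNReal.ofReal ((1 - p.eps) * S.loss p i (S.nn t i ω) ω * p.eps * Real.exp (-(p.mu *
        (p.beta * p.noise / p.c + 1 + 2 / p.c *
          (p.beta * p.gamma * (S.meanInterference p (S.nn t i ω) ω).toReal)))) / 2) := by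
  have hloss := loss_nn_pos_of_invSuccessBound_ne_top he0 he h
  have hc := SINRParams.c_pos hM he
  have he1 := sub_pos.mpr he
  have hK := p.successConst_pos he0 he
  rw [invSuccessBound, ← ENNReal.ofReal_toReal
      (meanInterference_nn_ne_top_of_invSuccessBound_ne_top hμ hM he0 he h),
    ENNReal.toReal_mul, ENNReal.toReal_ofReal (mul_nonneg hβ hγ),
    ← ENNReal.ofReal_mul (by positivity), eexp_ofReal (by positivity),
    ← ENNReal.ofReal_inv_of_pos hloss, ← ENNReal.ofReal_mul hK.le,
    ← ENNReal.ofReal_mul (by positivity), ← ENNReal.ofReal_inv_of_pos (by positivity),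
    SINRParams.successConst, mul_add p.mu _ (2 / p.c * _), neg_add, Real.exp_add, Real.exp_neg,
    Real.exp_neg]
  congr 1
  field_simp

theorem inv_invSuccessBound_le (hμ : 0 < p.mu) (hM : 0 < p.avgPower) (he0 : 0 < p.eps)
    (he : p.eps < 1) (hβ : 0 ≤ p.beta) (hγ : 0 ≤ p.gamma) (hN : 0 ≤ p.noise)
    (hne : S.nn t i ω ≠ i) (h : S.invSuccessBound p t i ω ≠ ∞) :
    (S.invSuccessBound p t i ω)⁻¹ ≤
      S.linkProb p t (S.fadeLevel p t i ω) i (S.nn t i ω) ω / 2 := by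
  have he1 := sub_pos.mpr he
  have hloss := S.loss_nonneg p i (S.nn t i ω) ω
  have hoff : p.eps ≤ 1 - S.txProb p t (S.nn t i ω) ω :=
    le_sub_comm.mp (S.txProb_le t hM.ne' he.le (S.nn t i ω) ω)
  have hnonneg := mul_nonneg (mul_nonneg he1.le hloss) (he0.le.trans hoff)
  have hlevel : (S.fadeLevel p t i ω : ℝ) ≤ _ :=
    fadeLevel_le (SINRParams.c_pos hM he).le hβ hγ hN
  rw [inv_invSuccessBound_eq hμ hM he0 he hβ hγ h, S.linkProb_eq hμ hne.symm,
    S.txProb_eq t hM.ne' i, ← ENNReal.ofReal_mul hnonneg,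
    ← ENNReal.ofReal_ofNat 2, ← ENNReal.ofReal_div_of_pos two_pos]
  gcongr

end Network

namespace IsNetwork

variable {Ω : Type*} [mΩ : MeasurableSpace Ω] {m : ℕ} {S : Network Ω m} {p : SINRParams}
  {Pr : Measure Ω} {Q : Measure PointConfig} {x : Plane} [IsFiniteMeasure Pr]

theorem setLIntegral_inv_invSuccessBound_le_of_fiber (h : IsNetwork S p Pr Q x)
    (hα : p.alpha ≠ 0) (hμ : 0 < p.mu) (hM : 0 < p.avgPower) (he0 : 0 < p.eps) (he : p.eps < 1)
    (hβ : 0 < p.beta) (hγ : 0 ≤ p.gamma) (hN : 0 ≤ p.noise) {t n i j : ℕ} {H : Set Ω}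
    (hH : MeasurableSet[S.history t] H) (hnn : ∀ ω ∈ H, S.nn t i ω = j)
    (hlevel : ∀ ω ∈ H, S.fadeLevel p t i ω = n) (hfin : ∀ ω ∈ H, S.invSuccessBound p t i ω ≠ ∞) :
    ∫⁻ ω in H, (S.invSuccessBound p t i ω)⁻¹ ∂Pr ≤ Pr (H ∩ S.success p t i) := by
  obtain rfl | ⟨ω₀, hω₀⟩ := H.eq_empty_or_nonempty
  · simp
  have hc := SINRParams.c_pos hM he
  have hloss : ∀ ω ∈ H, 0 < S.loss p i j ω := fun ω hω => by
    simpa only [hnn ω hω] using Network.loss_nn_pos_of_invSuccessBound_ne_top he0 he (hfin ω hω)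
  have hne : ∀ ω ∈ H, S.nn t i ω ≠ i := fun ω hω =>
    Network.nn_ne_of_loss_nn_pos hα (by simpa only [hnn ω hω] using hloss ω hω)
  have hcn : ∀ ω ∈ H, p.beta * p.noise +
      2 * (p.beta * p.gamma * (S.meanInterference p j ω).toReal) < p.c * n := fun ω hω => by
    simpa only [hnn ω hω, hlevel ω hω] using Network.beta_mul_noise_lt_c_mul_fadeLevel
      (S := S) (t := t) (i := i) (ω := ω) hc
  have hmean : ∀ ω ∈ H, ENNReal.ofReal (p.beta * p.gamma) * S.meanInterference p j ω ≤
      ENNReal.ofReal (p.c * n - p.beta * p.noise) / 2 := fun ω hω => by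
    have hw := Network.meanInterference_nn_ne_top_of_invSuccessBound_ne_top hμ hM he0 he
      (hfin ω hω)
    rw [hnn ω hω] at hw
    rw [← ENNReal.ofReal_toReal hw, ENNReal.toReal_mul,
      ENNReal.toReal_ofReal (mul_nonneg hβ.le hγ), ← ENNReal.ofReal_ofNat 2,
      ← ENNReal.ofReal_div_of_pos two_pos]
    exact ENNReal.ofReal_le_ofReal (by linarith [hcn ω hω])
  have hn : p.beta * p.noise < p.c * n :=
    (le_add_of_nonneg_right (by positivity)).trans_lt (hcn ω₀ hω₀)
  calc ∫⁻ ω in H, (S.invSuccessBound p t i ω)⁻¹ ∂Pr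
      ≤ ∫⁻ ω in H, S.linkProb p t n i j ω * 2⁻¹ ∂Pr := by
        refine setLIntegral_mono' (h.history_le t _ hH) fun ω hω => ?_
        simpa only [hnn ω hω, hlevel ω hω, ← div_eq_mul_inv] using
          Network.inv_invSuccessBound_le hμ hM he0 he hβ.le hγ hN (hne ω hω) (hfin ω hω)
    _ = Pr (H ∩ S.linkEvent t n i j) / 2 := by
        rw [lintegral_mul_const' _ _ (by simp), div_eq_mul_inv,
          h.measure_inter_linkEvent hμ hM.ne' he0.le he.le t n i j hH]
    _ ≤ Pr (H ∩ S.success p t i) :=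
        h.half_measure_linkEvent_le_measure_success hμ hM he0.le he hβ hN
          (hnn ω₀ hω₀ ▸ (hne ω₀ hω₀).symm) hH hnn (fun ω hω => (hloss ω hω).ne') hn hmean

theorem setLIntegral_inv_invSuccessBound_le (h : IsNetwork S p Pr Q x) (hα : p.alpha ≠ 0)
    (hμ : 0 < p.mu) (hM : 0 < p.avgPower) (he0 : 0 < p.eps) (he : p.eps < 1) (hβ : 0 < p.beta)
    (hγ : 0 ≤ p.gamma) (hN : 0 ≤ p.noise) (t i : ℕ) {H : Set Ω}
    (hH : MeasurableSet[S.history t] H) :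
    ∫⁻ ω in H, (S.invSuccessBound p t i ω)⁻¹ ∂Pr ≤ Pr (H ∩ S.success p t i) := by
  let X : Ω → ℕ × ℕ := fun ω => (S.nn t i ω, S.fadeLevel p t i ω)
  let R : Set Ω := {ω | S.invSuccessBound p t i ω ≠ ∞}
  have hX : Measurable[S.history t] X := by
    let _ := S.history t
    exact (Network.measurable_nn (S.measurable_pos_history t)
      (S.measurable_dest_history le_rfl) i).prodMk
      (Network.measurable_fadeLevel p (S.measurable_pos_history t)
        (S.measurable_dest_history le_rfl) i)
  have hR : MeasurableSet[S.history t] R := by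
    let _ := S.history t
    exact Network.measurable_invSuccessBound p (S.measurable_pos_history t)
      (S.measurable_dest_history le_rfl) i (measurableSet_singleton ∞).compl
  have hHR : MeasurableSet[S.history t] (H ∩ R) := MeasurableSet.inter hH hR
  calc ∫⁻ ω in H, (S.invSuccessBound p t i ω)⁻¹ ∂Pr
      = ∫⁻ ω in H ∩ R, (S.invSuccessBound p t i ω)⁻¹ ∂Pr := by
        rw [Set.inter_comm, ← setLIntegral_indicator (h.history_le t _ hR)]
        refine lintegral_congr fun ω => ?_
        by_cases hω : S.invSuccessBound p t i ω = ∞ <;> simp [R, hω]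
    _ ≤ Pr (H ∩ R ∩ S.success p t i) := by
        refine setLIntegral_le_measure_inter_of_fiber (hX.mono (h.history_le t) le_rfl)
          fun q => ?_
        exact h.setLIntegral_inv_invSuccessBound_le_of_fiber hα hμ hM he0 he hβ hγ hN
          (MeasurableSet.inter (hX (measurableSet_singleton q)) hHR)
          (fun ω hω => congrArg Prod.fst hω.1) (fun ω hω => congrArg Prod.snd hω.1)
          fun ω hω => hω.2.2
    _ ≤ Pr (H ∩ S.success p t i) :=
        measure_mono (Set.inter_subset_inter_left _ Set.inter_subset_left)

theorem lintegral_exitTime_le (h : IsNetwork S p Pr Q x) (hα : p.alpha ≠ 0) (hμ : 0 < p.mu)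
    (hM : 0 < p.avgPower) (he0 : 0 < p.eps) (he : p.eps < 1) (hβ : 0 < p.beta)
    (hγ : 0 ≤ p.gamma) (hN : 0 ≤ p.noise) (i : ℕ) {V : Ω → ℝ≥0∞}
    (hV : ∀ t, Measurable[S.history t] V) (hV0 : ∀ᵐ ω ∂Pr, V ω ≠ 0) (hVt : ∀ᵐ ω ∂Pr, V ω ≠ ∞)
    (hle : ∀ t, ∀ᵐ ω ∂Pr, S.invSuccessBound p t i ω ≤ V ω) :
    ∫⁻ ω, S.exitTime p i ω ∂Pr ≤ ∫⁻ ω, V ω ∂Pr := by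
  refine lintegral_iInf_hit_le (G := fun t => S.success p t i) (fun t =>
    Network.measurableSet_success p h.measurable_pos (h.measurable_dest t) (h.measurable_isOn t)
      (h.measurable_fade t) i) fun n => ?_
  have hmissed : MeasurableSet[S.history (n + 1)] (missedUpTo (fun t => S.success p t i) n) :=
    @Finset.measurableSet_biInter _ _ (S.history (n + 1)) _ _ fun s hs =>
      MeasurableSet.compl (S.measurableSet_success_history p
        (Nat.lt_succ_of_le (Finset.mem_Icc.mp hs).2) i)
  refine measure_le_setLIntegral_inter (h.history_le (n + 1)) (hV (n + 1)) hV0 hVt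
    (fun H hH => ?_) hmissed
  refine (lintegral_mono_ae (ae_restrict_of_ae ?_)).trans
    (h.setLIntegral_inv_invSuccessBound_le hα hμ hM he0 he hβ hγ hN (n + 1) i hH)
  filter_upwards [hle (n + 1)] with ω hω
  exact ENNReal.inv_le_inv.mpr hω

end IsNetwork

/-! ### Void sums -/

section VoidSum

variable {ι κ : Type*} {m : ℕ} {α : ℝ} {A : ℝ≥0∞} {f : ι → Plane}

/-- The shot noise at the lattice point `j` of the points `f i`, all moved to the lattice points of
their cells, with response function `latticeDecay α`. -/
noncomputable def latticeShotNoise (α : ℝ) (f : ι → Plane) (j : Fin 2 → ℤ) : ℝ≥0∞ :=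
  ∑' i, ENNReal.ofReal (latticeDecay α (latticeCell (f i) - j))

open Classical in
/-- A bound, up to a constant factor, for the inverse success probability of a node at the origin
among nodes at the points `f i`, whatever its destination cone is. In the summand of `k` and `j`,
the nearest neighbour is in the cell of `j` and the destination cone has index `k`, hence the ball
`innerBall m k (‖j‖ - 1) 0` is free of nodes. -/
noncomputable def voidSum (m : ℕ) (α : ℝ) (A : ℝ≥0∞) (f : ι → Plane) : ℝ≥0∞ :=
  ∑' (k : Fin m) (j : Fin 2 → ℤ),
    if ∀ i, f i ∉ innerBall m k (‖j‖ - 1) 0 then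
      ENNReal.ofReal ((2 * (‖j‖ + 1)) ^ α) * eexp (A * latticeShotNoise α f j)
    else 0

theorem voidSum_comp_equiv (e : κ ≃ ι) : voidSum m α A (f ∘ e) = voidSum m α A f := by
  refine tsum_congr fun k => tsum_congr fun j => ?_
  have hnoise : latticeShotNoise α (f ∘ e) j = latticeShotNoise α f j :=
    e.tsum_eq fun i => ENNReal.ofReal (latticeDecay α (latticeCell (f i) - j))
  rw [hnoise]
  congr 1
  exact propext (e.forall_congr_right (q := fun i => f i ∉ innerBall m k (‖j‖ - 1) 0))

theorem le_voidSum {k : Fin m} {j : Fin 2 → ℤ} (h : ∀ i, f i ∉ innerBall m k (‖j‖ - 1) 0) :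
    ENNReal.ofReal ((2 * (‖j‖ + 1)) ^ α) * eexp (A * latticeShotNoise α f j) ≤
      voidSum m α A f := by
  refine le_trans ?_ ((ENNReal.le_tsum j).trans (ENNReal.le_tsum k))
  rw [if_pos h]

theorem one_le_ofReal_rpow_mul_eexp (hα : 0 ≤ α) (j : Fin 2 → ℤ) (s : ℝ≥0∞) :
    1 ≤ ENNReal.ofReal ((2 * (‖j‖ + 1)) ^ α) * eexp s :=
  one_le_mul (ENNReal.one_le_ofReal.mpr
    (Real.one_le_rpow (by linarith [norm_nonneg j]) hα)) (one_le_eexp s)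

theorem one_le_voidSum (hm : 0 < m) (hα : 0 ≤ α) : 1 ≤ voidSum m α A f :=
  (one_le_ofReal_rpow_mul_eexp hα 0 _).trans (le_voidSum (k := ⟨0, hm⟩) fun i hi => by
    have := norm_lt_of_mem_innerBall_zero hi
    rw [norm_zero] at this
    linarith [norm_nonneg (f i)])

theorem voidSum_eq_top (hm : 2 < m) (hα : 0 ≤ α) {k : Fin m} (h : ∀ i, f i ∉ cone m k) :
    voidSum m α A f = ∞ := by
  refine top_le_iff.mp (le_trans ?_ (ENNReal.le_tsum k))
  rw [← ENNReal.tsum_const_eq_top_of_ne_zero (α := Fin 2 → ℤ) one_ne_zero]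
  refine ENNReal.tsum_le_tsum fun j => ?_
  rw [if_pos fun i hi => h i (innerBall_zero_subset_cone hm k _ hi)]
  exact one_le_ofReal_rpow_mul_eexp hα j _

theorem measurable_voidSum [Countable ι] {Ω : Type*} [MeasurableSpace Ω] (m : ℕ) (α : ℝ)
    (A : ℝ≥0∞) {f : ι → Ω → Plane} (hf : ∀ i, Measurable (f i)) :
    Measurable fun ω => voidSum m α A fun i => f i ω := by
  refine Measurable.tsum fun k => Measurable.tsum fun j => Measurable.ite ?_ ?_ measurable_const
  · simp only [Set.ofPred_forall]
    exact MeasurableSet.iInter fun i => hf i measurableSet_innerBall.compl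
  · refine (continuous_eexp.measurable.comp ((Measurable.tsum fun i => ?_).const_mul A)).const_mul _
    exact ((measurable_of_countable fun l : Fin 2 → ℤ => latticeDecay α (l - j)).comp
      (measurable_latticeCell.comp (hf i))).ennreal_ofReal

end VoidSum

/-- The factor of the shot noise in the void sum that bounds `Network.invSuccessBound`. -/
noncomputable def SINRParams.noiseFactor (p : SINRParams) : ℝ≥0∞ :=
  ENNReal.ofReal (2 * p.mu / p.c) * (ENNReal.ofReal (p.beta * p.gamma) *
    (ENNReal.ofReal p.avgPower * meanFade p.mu * ENNReal.ofReal (4 ^ p.alpha)))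

theorem SINRParams.noiseFactor_ne_top {p : SINRParams} (hμ : 0 < p.mu) : p.noiseFactor ≠ ∞ := by
  have := (meanFade_lt_top hμ).ne
  unfold noiseFactor
  finiteness

namespace Network

variable {Ω : Type*} {m : ℕ} {S : Network Ω m} {p : SINRParams} {t i : ℕ} {ω : Ω}

theorem exists_isNearest {φ : PointConfig} (hinj : Function.Injective fun j => S.pos j ω)
    (hφ : Set.range (fun j => S.pos j ω) = φ.points)
    (h : ∃ k, k ≠ i ∧ S.pos k ω - S.pos i ω ∈ cone m (S.dest t i ω)) :
    ∃ j, S.IsNearest t i j ω := by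
  obtain ⟨k, hk, hkc⟩ := h
  let B := Metric.closedBall (S.pos i ω) (dist (S.pos i ω) (S.pos k ω))
  let C : Set ℕ := {l | l ≠ i ∧ S.pos l ω - S.pos i ω ∈ cone m (S.dest t i ω) ∧ S.pos l ω ∈ B}
  have hfin : C.Finite :=
    ((φ.locallyFinite B Metric.isBounded_closedBall).preimage hinj.injOn).subset
      fun l hl => ⟨hφ ▸ ⟨l, rfl⟩, hl.2.2⟩
  have hkB : S.pos k ω ∈ B := Metric.mem_closedBall'.mpr le_rfl
  obtain ⟨j, ⟨hji, hjc, hjB⟩, hmin⟩ := Set.exists_min_image C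
    (fun l => dist (S.pos i ω) (S.pos l ω)) hfin ⟨k, hk, hkc, hkB⟩
  refine ⟨j, hji, hjc, fun l hl hlc => ?_⟩
  by_cases hlB : S.pos l ω ∈ B
  · exact hmin l ⟨hl, hlc, hlB⟩
  · rw [Metric.mem_closedBall', not_le] at hlB
    exact (Metric.mem_closedBall'.mp hjB).trans hlB.le

theorem isNearest_nn_of_voidSum_ne_top (hm : 2 < m) {α : ℝ} (hα : 0 ≤ α) {A : ℝ≥0∞}
    {φ : PointConfig} (hinj : Function.Injective fun j => S.pos j ω)
    (hφ : Set.range (fun j => S.pos j ω) = φ.points)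
    (hfin : voidSum m α A (fun j => S.pos j ω - S.pos i ω) ≠ ∞) :
    S.IsNearest t i (S.nn t i ω) ω := by
  obtain ⟨k, hk⟩ : ∃ k, S.pos k ω - S.pos i ω ∈ cone m (S.dest t i ω) := by
    by_contra! hempty
    exact hfin (voidSum_eq_top hm hα hempty)
  refine Nat.sInf_mem (exists_isNearest hinj hφ ⟨k, ?_, hk⟩)
  rintro rfl
  exact zero_notMem_cone m _ (sub_self (S.pos k ω) ▸ hk)

theorem IsNearest.notMem_innerBall (hm : 2 < m) {j : ℕ} (h : S.IsNearest t i j ω) (k : ℕ) :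
    S.pos k ω - S.pos i ω ∉
      innerBall m (S.dest t i ω) (‖latticeCell (S.pos j ω - S.pos i ω)‖ - 1) 0 := by
  intro hk
  have hkc := innerBall_zero_subset_cone hm _ _ hk
  have hki : k ≠ i := by
    rintro rfl
    exact zero_notMem_cone m _ (sub_self (S.pos k ω) ▸ hkc)
  have hjk := h.2.2 k hki hkc
  rw [dist_comm, dist_eq_norm, dist_comm, dist_eq_norm] at hjk
  linarith [norm_lt_of_mem_innerBall_zero hk, norm_latticeCell_le (S.pos j ω - S.pos i ω)]

theorem meanInterference_le_latticeShotNoise (hα : 0 < p.alpha) (j : ℕ) :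
    S.meanInterference p j ω ≤ ENNReal.ofReal p.avgPower * meanFade p.mu *
      (ENNReal.ofReal (4 ^ p.alpha) * latticeShotNoise p.alpha (fun z => S.pos z ω - S.pos i ω)
        (latticeCell (S.pos j ω - S.pos i ω))) := by
  rw [meanInterference, latticeShotNoise]
  refine mul_le_mul_right ?_ _
  rw [← ENNReal.tsum_mul_left]
  refine ENNReal.tsum_le_tsum fun z => ?_
  rw [← ENNReal.ofReal_mul (by positivity)]
  refine ENNReal.ofReal_le_ofReal ?_
  simpa only [loss, dist_sub_right] using
    pathLoss_dist_le_latticeDecay hα (S.pos z ω - S.pos i ω) (S.pos j ω - S.pos i ω)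

theorem IsNearest.inv_loss_le {j : ℕ} (h : S.IsNearest t i j ω) (hα : 0 ≤ p.alpha) :
    (ENNReal.ofReal (S.loss p i j ω))⁻¹ ≤
      ENNReal.ofReal ((2 * (‖latticeCell (S.pos j ω - S.pos i ω)‖ + 1)) ^ p.alpha) := by
  have hne : S.pos j ω - S.pos i ω ≠ 0 := fun h0 => zero_notMem_cone m _ (h0 ▸ h.2.1)
  have hpos : 0 < pathLoss p.alpha ‖S.pos j ω - S.pos i ω‖ :=
    lt_min (Real.rpow_pos_of_pos (norm_pos_iff.mpr hne) _) one_pos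
  rw [loss, dist_comm, dist_eq_norm, ← ENNReal.ofReal_inv_of_pos hpos]
  exact ENNReal.ofReal_le_ofReal (inv_pathLoss_norm_le hα hne)

theorem invSuccessBound_le_voidSum (hm : 2 < m) (hα : 0 < p.alpha) {φ : PointConfig}
    (hinj : Function.Injective fun j => S.pos j ω)
    (hφ : Set.range (fun j => S.pos j ω) = φ.points)
    (hfin : voidSum m p.alpha p.noiseFactor (fun j => S.pos j ω - S.pos i ω) ≠ ∞) :
    S.invSuccessBound p t i ω ≤ ENNReal.ofReal p.successConst *
      voidSum m p.alpha p.noiseFactor (fun j => S.pos j ω - S.pos i ω) := by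
  have hnear : S.IsNearest t i (S.nn t i ω) ω :=
    isNearest_nn_of_voidSum_ne_top hm hα.le hinj hφ hfin
  rw [invSuccessBound, mul_assoc]
  gcongr
  refine le_trans ?_ (le_voidSum (hnear.notMem_innerBall hm))
  refine mul_le_mul' (hnear.inv_loss_le hα.le) (eexp_mono ?_)
  grw [meanInterference_le_latticeShotNoise (i := i) hα]
  rw [SINRParams.noiseFactor]
  ring_nf
  rfl

end Network

/-! ### Counts in lattice cells -/

/-- The half-open unit square of the points whose difference to `x` is in the lattice cell `i`. -/
def unitSquare (x : Plane) (i : Fin 2 → ℤ) : Set Plane := {z | latticeCell (z - x) = i}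

theorem measurableSet_unitSquare (x : Plane) (i : Fin 2 → ℤ) : MeasurableSet (unitSquare x i) :=
  (measurable_latticeCell.comp (measurable_id.sub_const x)) (measurableSet_singleton i)

theorem isBounded_unitSquare (x : Plane) (i : Fin 2 → ℤ) :
    Bornology.IsBounded (unitSquare x i) := by
  refine (Metric.isBounded_closedBall (x := x) (r := 2 * (‖i‖ + 1))).subset ?_
  rintro z rfl
  rw [Metric.mem_closedBall, dist_eq_norm]
  exact norm_le_two_mul_norm_latticeCell _

theorem pairwise_disjoint_unitSquare (x : Plane) :
    Pairwise fun i j => Disjoint (unitSquare x i) (unitSquare x j) := fun _ _ hij =>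
  Set.disjoint_left.mpr fun _ hz hz' => hij (hz.symm.trans hz')

theorem volume_unitSquare_zero (i : Fin 2 → ℤ) : volume (unitSquare 0 i) = 1 := by
  have h : unitSquare 0 i = (MeasurableEquiv.toLp 2 (Fin 2 → ℝ)).symm ⁻¹'
      Set.univ.pi fun l => Set.Ico (i l : ℝ) (i l + 1) := by
    ext z
    simp only [unitSquare, sub_zero, latticeCell, Set.mem_preimage, Set.mem_univ_pi, Set.mem_Ico,
      Set.mem_ofPred_eq, funext_iff, Int.floor_eq_iff]
    rfl
  rw [h, (EuclideanSpace.volume_preserving_symm_measurableEquiv_toLp (Fin 2)).measure_preimage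
    (MeasurableSet.univ_pi fun l => measurableSet_Ico).nullMeasurableSet, Real.volume_pi_Ico]
  simp

namespace PointConfig

theorem measurable_count {A : Set Plane} (hA : MeasurableSet A) (hb : Bornology.IsBounded A) :
    Measurable fun φ : PointConfig => φ.count A :=
  (comap_measurable (m := ⊤) fun φ : PointConfig => φ.count A).mono
    (le_iSup_of_le A (le_iSup_of_le hA (le_iSup_of_le hb le_rfl))) le_rfl

theorem count_eq_zero_iff (φ : PointConfig) {A : Set Plane} (hb : Bornology.IsBounded A) :
    φ.count A = 0 ↔ ∀ z : φ.points, (z : Plane) ∉ A := by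
  rw [count, Set.ncard_eq_zero (φ.locallyFinite A hb), Set.eq_empty_iff_forall_notMem]
  exact ⟨fun h z hz => h z ⟨z.2, hz⟩, fun h z hz => h ⟨z, hz.1⟩ hz.2⟩

theorem count_eq_tsum_indicator (φ : PointConfig) {A : Set Plane} (hb : Bornology.IsBounded A) :
    (φ.count A : ℝ≥0∞) = ∑' z : φ.points, A.indicator 1 (z : Plane) := by
  have hfin := φ.locallyFinite A hb
  rw [tsum_subtype φ.points (A.indicator 1), Set.indicator_indicator, ← tsum_subtype, count,
    ← ENat.toENNReal_coe, hfin.cast_ncard_eq]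
  exact (ENNReal.tsum_set_one _).symm

section ShotNoise

variable {ι : Type*} {A : ι → Set Plane} {g h : ι → ℝ}

/-- The sum over the points `z` of the configuration of the values `g i` with `z ∈ A i`. -/
noncomputable def shotNoise (A : ι → Set Plane) (g : ι → ℝ) (φ : PointConfig) : ℝ≥0∞ :=
  ∑' i, (φ.count (A i) : ℝ≥0∞) * ENNReal.ofReal (g i)

theorem measurable_shotNoise [Countable ι] (hA : ∀ i, MeasurableSet (A i))
    (hb : ∀ i, Bornology.IsBounded (A i)) : Measurable (shotNoise A g) :=
  Measurable.tsum fun i =>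
    ((measurable_of_countable ((↑) : ℕ → ℝ≥0∞)).comp (measurable_count (hA i) (hb i))).mul_const _

theorem shotNoise_add (hg : 0 ≤ g) (hh : 0 ≤ h) (φ : PointConfig) :
    φ.shotNoise A (g + h) = φ.shotNoise A g + φ.shotNoise A h := by
  simp only [shotNoise, Pi.add_apply, ENNReal.ofReal_add (hg _) (hh _), mul_add,
    ENNReal.tsum_add]

theorem shotNoise_single [DecidableEq ι] (i : ι) (φ : PointConfig) :
    φ.shotNoise A (Pi.single i 1) = φ.count (A i) := by
  rw [shotNoise, tsum_eq_single i fun j hj => by simp [hj]]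
  simp

theorem shotNoise_const_mul {a : ℝ} (ha : 0 ≤ a) (φ : PointConfig) :
    φ.shotNoise A (fun i => a * g i) = ENNReal.ofReal a * φ.shotNoise A g := by
  simp only [shotNoise, ENNReal.ofReal_mul ha, mul_left_comm _ (ENNReal.ofReal a),
    ENNReal.tsum_mul_left]

theorem count_mul_eexp_shotNoise_le [DecidableEq ι] (hg : 0 ≤ g) (i : ι) (φ : PointConfig) :
    φ.count (A i) * eexp (φ.shotNoise A g) ≤ eexp (φ.shotNoise A (g + Pi.single i 1)) := by
  rw [shotNoise_add hg (Pi.single_nonneg.mpr zero_le_one), shotNoise_single, eexp_add, mul_comm]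
  gcongr
  exact natCast_le_eexp _

end ShotNoise

theorem shotNoise_unitSquare (φ : PointConfig) (x : Plane) (g : (Fin 2 → ℤ) → ℝ) :
    φ.shotNoise (unitSquare x) g =
      ∑' z : φ.points, ENNReal.ofReal (g (latticeCell ((z : Plane) - x))) := by
  simp only [shotNoise, φ.count_eq_tsum_indicator (isBounded_unitSquare x _),
    ← ENNReal.tsum_mul_right]
  rw [ENNReal.tsum_comm]
  refine tsum_congr fun z => ?_
  rw [tsum_eq_single (latticeCell ((z : Plane) - x))]
  · simp [unitSquare]
  · intro i hi
    simp [unitSquare, hi.symm]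

theorem latticeShotNoise_points (α : ℝ) (φ : PointConfig) (x : Plane) (j : Fin 2 → ℤ) :
    latticeShotNoise α (fun z : φ.points => (z : Plane) - x) j =
      φ.shotNoise (unitSquare x) fun i => latticeDecay α (i - j) :=
  (φ.shotNoise_unitSquare x fun i => latticeDecay α (i - j)).symm

theorem measurable_voidSum (m : ℕ) (α : ℝ) (A : ℝ≥0∞) (x : Plane) :
    Measurable fun φ : PointConfig => voidSum m α A fun z : φ.points => (z : Plane) - x := by
  refine Measurable.tsum fun k => Measurable.tsum fun j => Measurable.ite ?_ ?_ measurable_const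
  · let D : Set Plane := (fun z => z - x) ⁻¹' innerBall m k (‖j‖ - 1) 0
    have hDb : Bornology.IsBounded D :=
      (IsometryEquiv.subRight x).isometry.antilipschitz.isBounded_preimage isBounded_innerBall
    have hvoid : {φ : PointConfig | ∀ z : φ.points, (z : Plane) - x ∉
        innerBall m k (‖j‖ - 1) 0} = (fun φ : PointConfig => φ.count D) ⁻¹' {0} := by
      ext φ
      exact (φ.count_eq_zero_iff hDb).symm
    rw [hvoid]
    exact measurable_count (measurableSet_innerBall.preimage (measurable_id.sub_const x)) hDb
      (measurableSet_singleton 0)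
  · simp only [latticeShotNoise_points]
    exact (continuous_eexp.measurable.comp ((measurable_shotNoise (measurableSet_unitSquare x)
      (isBounded_unitSquare x)).const_mul A)).const_mul _

end PointConfig

/-! ### Poisson and Palm expectations -/

theorem setLIntegral_le_measure_rpow_mul {Ω : Type*} [MeasurableSpace Ω] {P : Measure Ω}
    {f : Ω → ℝ≥0∞} (hf : Measurable f) (s : Set Ω) :
    ∫⁻ ω in s, f ω ∂P ≤ P s ^ (1 / 2 : ℝ) * (∫⁻ ω, f ω * f ω ∂P) ^ (1 / 2 : ℝ) := by
  have hholder := ENNReal.lintegral_mul_le_Lp_mul_Lq (P.restrict s) Real.HolderConjugate.two_two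
    (aemeasurable_const (b := 1)) hf.aemeasurable
  simp only [Pi.mul_apply, one_mul, lintegral_one, Measure.restrict_apply_univ,
    ENNReal.rpow_ofNat, sq] at hholder
  refine hholder.trans (mul_le_mul_right ?_ _)
  gcongr
  exact Measure.restrict_le_self

theorem exp_sub_one_le_mul_exp {g b : ℝ} (hg : 0 ≤ g) (hgb : g ≤ b) :
    Real.exp g - 1 ≤ Real.exp b * g := by
  have hneg : 1 - g ≤ Real.exp (-g) := by linarith [Real.add_one_le_exp (-g)]
  have hmul : Real.exp g * (1 - g) ≤ 1 := by
    grw [hneg]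
    rw [← Real.exp_add, add_neg_cancel, Real.exp_zero]
  have hexp : Real.exp g * g ≤ Real.exp b * g := by gcongr
  linarith

namespace IsPoissonLaw

variable {lam : ℝ} {P : Measure PointConfig}

theorem lintegral_eexp_count (h : IsPoissonLaw lam P) (hlam : 0 ≤ lam) {A : Set Plane}
    (hA : MeasurableSet A) (hb : Bornology.IsBounded A) {g : ℝ} (hg : 0 ≤ g) :
    ∫⁻ φ, eexp (φ.count A * ENNReal.ofReal g) ∂P =
      ENNReal.ofReal (Real.exp (lam * (volume : Measure Plane).real A * (Real.exp g - 1))) := by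
  rw [(h.count_law A hA hb).lintegral_comp (f := fun n : ℕ => eexp (n * ENNReal.ofReal g))
    (measurable_of_countable _).aemeasurable, lintegral_eexp_poissonMeasure _ hg,
    Real.coe_toNNReal _ (by positivity)]

theorem measure_count_eq_zero (h : IsPoissonLaw lam P) (hlam : 0 ≤ lam) {A : Set Plane}
    (hA : MeasurableSet A) (hb : Bornology.IsBounded A) :
    P {φ | φ.count A = 0} =
      ENNReal.ofReal (Real.exp (-(lam * (volume : Measure Plane).real A))) := by
  change P ((fun φ : PointConfig => φ.count A) ⁻¹' {0}) = _
  rw [← Measure.map_apply (PointConfig.measurable_count hA hb) (measurableSet_singleton 0),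
    (h.count_law A hA hb).map_eq, poissonMeasure_singleton, Real.coe_toNNReal _ (by positivity)]
  simp

section ShotNoise

variable {ι : Type*} {A : ι → Set Plane} {g : ι → ℝ}

theorem lintegral_prod_eexp_count (h : IsPoissonLaw lam P) (hlam : 0 ≤ lam)
    (hA : ∀ i, MeasurableSet (A i)) (hb : ∀ i, Bornology.IsBounded (A i))
    (hd : Pairwise fun i j => Disjoint (A i) (A j)) (hg : 0 ≤ g) (s : Finset ι) :
    ∫⁻ φ, ∏ i ∈ s, eexp (φ.count (A i) * ENNReal.ofReal (g i)) ∂P =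
      ∏ i ∈ s, ENNReal.ofReal
        (Real.exp (lam * (volume : Measure Plane).real (A i) * (Real.exp (g i) - 1))) := by
  let e : Fin s.card ≃ s := s.equivFin.symm
  have hreindex (f : ι → ℝ≥0∞) : ∏ i ∈ s, f i = ∏ l, f (e l) := by
    rw [← Finset.prod_coe_sort s f]
    exact (e.prod_comp fun i : s => f i).symm
  have hindep := (h.count_indep s.card (fun l => A (e l)) (fun l => hA _) (fun l => hb _)
    fun l l' hl => hd fun heq => hl (e.injective (Subtype.ext heq))).comp
      (fun l (n : ℕ) => eexp (n * ENNReal.ofReal (g (e l)))) fun l => measurable_of_countable _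
  simp only [hreindex]
  refine (lintegral_prod_eq_prod_lintegral_of_indepFun Finset.univ _ hindep fun l =>
    (measurable_of_countable _).comp (PointConfig.measurable_count (hA _) (hb _))).trans ?_
  exact Finset.prod_congr rfl fun l _ => h.lintegral_eexp_count hlam (hA _) (hb _) (hg _)

theorem lintegral_eexp_shotNoise_le [Countable ι] (h : IsPoissonLaw lam P) (hlam : 0 ≤ lam)
    (hA : ∀ i, MeasurableSet (A i)) (hb : ∀ i, Bornology.IsBounded (A i))
    (hd : Pairwise fun i j => Disjoint (A i) (A j)) (hg : 0 ≤ g) {b : ℝ} (hgb : ∀ i, g i ≤ b)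
    (hs : Summable fun i => (volume : Measure Plane).real (A i) * g i) :
    ∫⁻ φ, eexp (φ.shotNoise A g) ∂P ≤ ENNReal.ofReal
      (Real.exp (lam * (Real.exp b * ∑' i, (volume : Measure Plane).real (A i) * g i))) := by
  have hmono : Monotone fun (s : Finset ι) (φ : PointConfig) =>
      ∏ i ∈ s, eexp (φ.count (A i) * ENNReal.ofReal (g i)) := fun s t hst φ =>
    Finset.prod_le_prod_of_subset_of_one_le' hst fun i _ _ => one_le_eexp _
  have hmeas (s : Finset ι) : Measurable fun φ : PointConfig =>
      ∏ i ∈ s, eexp (φ.count (A i) * ENNReal.ofReal (g i)) :=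
    Finset.measurable_fun_prod _ fun i _ =>
      (measurable_of_countable fun n : ℕ => eexp (n * ENNReal.ofReal (g i))).comp
        (PointConfig.measurable_count (hA i) (hb i))
  simp only [PointConfig.shotNoise, eexp_tsum]
  rw [lintegral_iSup_directed (fun s => (hmeas s).aemeasurable) hmono.directed_le]
  refine iSup_le fun s => ?_
  rw [h.lintegral_prod_eexp_count hlam hA hb hd hg s,
    ← ENNReal.ofReal_prod_of_nonneg fun _ _ => (Real.exp_pos _).le, ← Real.exp_sum]
  refine ENNReal.ofReal_le_ofReal (Real.exp_le_exp.mpr ?_)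
  calc ∑ i ∈ s, lam * (volume : Measure Plane).real (A i) * (Real.exp (g i) - 1)
      ≤ ∑ i ∈ s, lam * (volume : Measure Plane).real (A i) * (Real.exp b * g i) := by
        gcongr with i
        exact exp_sub_one_le_mul_exp (hg i) (hgb i)
    _ = lam * (Real.exp b * ∑ i ∈ s, (volume : Measure Plane).real (A i) * g i) := by
        rw [Finset.mul_sum, Finset.mul_sum]
        exact Finset.sum_congr rfl fun i _ => by ring
    _ ≤ _ := by
        gcongr
        exact hs.sum_le_tsum _ fun i _ => mul_nonneg measureReal_nonneg (hg i)

theorem setLIntegral_void_eexp_shotNoise_le [Countable ι] (h : IsPoissonLaw lam P)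
    (hlam : 0 ≤ lam) (hA : ∀ i, MeasurableSet (A i)) (hb : ∀ i, Bornology.IsBounded (A i))
    (hd : Pairwise fun i j => Disjoint (A i) (A j)) (hg : 0 ≤ g) {b : ℝ} (hgb : ∀ i, g i ≤ b)
    (hs : Summable fun i => (volume : Measure Plane).real (A i) * g i) {D : Set Plane}
    (hD : MeasurableSet D) (hDb : Bornology.IsBounded D) :
    ∫⁻ φ in {φ | φ.count D = 0}, eexp (φ.shotNoise A g) ∂P ≤
      ENNReal.ofReal (Real.exp (-(lam * (volume : Measure Plane).real D / 2))) *
        ENNReal.ofReal (Real.exp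
          (lam * (Real.exp (2 * b) * ∑' i, (volume : Measure Plane).real (A i) * g i))) := by
  have hsquare (φ : PointConfig) : eexp (φ.shotNoise A g) * eexp (φ.shotNoise A g) =
      eexp (φ.shotNoise A fun i => 2 * g i) := by
    rw [← eexp_add, φ.shotNoise_const_mul two_pos.le, ENNReal.ofReal_ofNat, two_mul]
  have hs2 : Summable fun i => (volume : Measure Plane).real (A i) * (2 * g i) :=
    (hs.mul_left 2).congr fun i => mul_left_comm _ _ _
  have hexp := h.lintegral_eexp_shotNoise_le hlam hA hb hd (g := fun i => 2 * g i)
    (fun i => mul_nonneg two_pos.le (hg i)) (b := 2 * b)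
    (fun i => mul_le_mul_of_nonneg_left (hgb i) two_pos.le) hs2
  refine (setLIntegral_le_measure_rpow_mul (f := fun φ : PointConfig => eexp (φ.shotNoise A g))
    (continuous_eexp.measurable.comp (PointConfig.measurable_shotNoise hA hb)) _).trans ?_
  simp only [hsquare]
  refine (mul_le_mul_right (ENNReal.rpow_le_rpow hexp one_half_pos.le) _).trans_eq ?_
  rw [h.measure_count_eq_zero hlam hD hDb,
    ENNReal.ofReal_rpow_of_nonneg (Real.exp_pos _).le one_half_pos.le, ← Real.exp_mul,
    ENNReal.ofReal_rpow_of_nonneg (Real.exp_pos _).le one_half_pos.le, ← Real.exp_mul]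
  simp only [mul_left_comm _ (2 : ℝ), tsum_mul_left]
  congr 3 <;> ring

end ShotNoise

end IsPoissonLaw

theorem sum_mul_ncard_fiber_le {β : Type*} {T : Set β} (hT : T.Finite) {u : β → ℝ≥0∞}
    {R : Finset ℝ≥0∞} (hR : Set.MapsTo u T R) {c : ℝ≥0∞} (hu : ∀ y ∈ T, u y ≤ c) :
    ∑ r ∈ R, r * ({y | y ∈ T ∧ u y = r}.ncard : ℝ≥0∞) ≤ T.ncard * c := by
  classical
  lift T to Finset β using hT
  have hfiber (r : ℝ≥0∞) : {y | y ∈ (T : Set β) ∧ u y = r}.ncard = {y ∈ T | u y = r}.card := by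
    rw [← Set.ncard_coe_finset, Finset.coe_filter]
    rfl
  simp only [hfiber, Set.ncard_coe_finset, Finset.card_eq_sum_card_fiberwise hR, Nat.cast_sum,
    Finset.sum_mul]
  refine Finset.sum_le_sum fun r _ => ?_
  rw [mul_comm]
  obtain hempty | ⟨y, hy⟩ := {y ∈ T | u y = r}.eq_empty_or_nonempty
  · simp [hempty]
  · obtain ⟨hyT, rfl⟩ := Finset.mem_filter.mp hy
    gcongr
    exact hu y hyT

/-- The Campbell formula for events passes to `F` through the level sets of the simple functions
below `F`. -/
theorem IsPalmLaw.mul_lintegral_le {lam : ℝ} {P Q : Measure PointConfig} {x : Plane}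
    (h : IsPalmLaw lam P x Q) {B : Set Plane} (hB : MeasurableSet B)
    (hBb : Bornology.IsBounded B) {F G : PointConfig → ℝ≥0∞}
    (hFG : ∀ φ : PointConfig, ∀ y ∈ φ.points ∩ B, F (φ.translate (x - y)) ≤ G φ) :
    ENNReal.ofReal lam * volume B * ∫⁻ φ, F φ ∂Q ≤ ∫⁻ φ, φ.count B * G φ ∂P := by
  rw [lintegral, ENNReal.mul_iSup]
  refine iSup_le fun f => ?_
  rw [ENNReal.mul_iSup]
  refine iSup_le fun hf => ?_
  let hits (r : ℝ≥0∞) (φ : PointConfig) : ℝ≥0∞ :=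
    ({y | y ∈ φ.points ∩ B ∧ f (φ.translate (x - y)) = r}.ncard : ℕ)
  calc ENNReal.ofReal lam * volume B * f.lintegral Q
      = ∑ r ∈ f.range, r * ∫⁻ φ, hits r φ ∂P := by
        rw [SimpleFunc.lintegral, Finset.mul_sum]
        refine Finset.sum_congr rfl fun r _ => ?_
        rw [mul_left_comm, ← h.campbell B hB hBb _ (f.measurableSet_fiber r)]
        rfl
    _ ≤ ∑ r ∈ f.range, ∫⁻ φ, r * hits r φ ∂P :=
        Finset.sum_le_sum fun r _ => lintegral_const_mul_le _ _
    _ ≤ ∫⁻ φ, ∑ r ∈ f.range, r * hits r φ ∂P := sum_lintegral_le_lintegral_sum _ _ _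
    _ ≤ ∫⁻ φ, φ.count B * G φ ∂P := lintegral_mono fun φ =>
        sum_mul_ncard_fiber_le (φ.locallyFinite B hBb) (fun y _ => f.mem_range_self _)
          fun y hy => (hf _).trans (hFG φ y hy)

/-! ### Palm expectation of the void sum -/

theorem one_add_rpow_mul_exp_neg_sq_le {p κ u : ℝ} (hp : 0 ≤ p) (hκ : 0 < κ) (hu : 0 ≤ u) :
    (1 + u) ^ p * Real.exp (-(κ * u ^ 2)) ≤ Real.exp (p ^ 2 / (4 * κ)) := by
  have hrpow : (1 + u) ^ p ≤ Real.exp (p * u) := by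
    rw [mul_comm, Real.exp_mul]
    exact Real.rpow_le_rpow (by linarith) (by linarith [Real.add_one_le_exp u]) hp
  calc (1 + u) ^ p * Real.exp (-(κ * u ^ 2)) ≤ Real.exp (p * u) * Real.exp (-(κ * u ^ 2)) := by
        gcongr
    _ = Real.exp (p * u - κ * u ^ 2) := by rw [← Real.exp_add, sub_eq_add_neg]
    _ ≤ _ := by
        refine Real.exp_le_exp.mpr ?_
        rw [le_div_iff₀ (by positivity)]
        nlinarith [sq_nonneg (p - 2 * κ * u)]

theorem one_add_le_mul_one_add_max {σ t : ℝ} (hσ : 0 < σ) :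
    1 + t ≤ (6 / σ + 2) * (1 + max ((t - 1) / 2 * σ - 2) 0) := by
  set u := max ((t - 1) / 2 * σ - 2) 0
  have hu0 : 0 ≤ u := le_max_right _ _
  have hut : (t - 1) / 2 * σ - 2 ≤ u := le_max_left _ _
  have ht : t - 1 ≤ (2 * u + 4) / σ := by
    rw [le_div_iff₀ hσ]
    linarith
  calc 1 + t ≤ (2 * u + 4) / σ + 2 := by linarith
    _ ≤ (6 + 6 * u) / σ + 2 * (1 + u) :=
        add_le_add (div_le_div_of_nonneg_right (by linarith) hσ.le) (by linarith)
    _ = (6 / σ + 2) * (1 + u) := by ring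

theorem one_add_rpow_mul_exp_neg_sq_max_le {p κ σ t : ℝ} (hp : 0 ≤ p) (hκ : 0 < κ) (hσ : 0 < σ)
    (ht : 0 ≤ t) :
    (1 + t) ^ p * Real.exp (-(κ * max ((t - 1) / 2 * σ - 2) 0 ^ 2)) ≤
      (6 / σ + 2) ^ p * Real.exp (p ^ 2 / (4 * κ)) := by
  set u := max ((t - 1) / 2 * σ - 2) 0
  have hu0 : 0 ≤ u := le_max_right _ _
  calc (1 + t) ^ p * Real.exp (-(κ * u ^ 2))
      ≤ ((6 / σ + 2) * (1 + u)) ^ p * Real.exp (-(κ * u ^ 2)) := by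
        gcongr
        exact one_add_le_mul_one_add_max hσ
    _ = (6 / σ + 2) ^ p * ((1 + u) ^ p * Real.exp (-(κ * u ^ 2))) := by
        rw [Real.mul_rpow (by positivity) (by positivity), mul_assoc]
    _ ≤ _ := by
        gcongr
        exact one_add_rpow_mul_exp_neg_sq_le hp hκ hu0

theorem summable_rpow_mul_exp_neg_sq {α κ σ : ℝ} (hα : 0 ≤ α) (hκ : 0 < κ) (hσ : 0 < σ) :
    Summable fun j : Fin 2 → ℤ => (2 * (‖j‖ + 1)) ^ α *
      Real.exp (-(κ * max ((‖j‖ - 1) / 2 * σ - 2) 0 ^ 2)) := by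
  refine Summable.of_nonneg_of_le (fun j => by positivity) (fun j => ?_)
    ((summable_latticeDecay (α := 3) (by norm_num)).mul_left
      (2 ^ α * ((6 / σ + 2) ^ (α + 3) * Real.exp ((α + 3) ^ 2 / (4 * κ)))))
  have hsplit : (2 * (‖j‖ + 1)) ^ α = 2 ^ α * ((1 + ‖j‖) ^ (α + 3) * latticeDecay 3 j) := by
    rw [latticeDecay, ← Real.rpow_add (by positivity), add_neg_cancel_right,
      Real.mul_rpow two_pos.le (by positivity), add_comm 1]
  set E := Real.exp (-(κ * max ((‖j‖ - 1) / 2 * σ - 2) 0 ^ 2))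
  calc (2 * (‖j‖ + 1)) ^ α * E = 2 ^ α * ((1 + ‖j‖) ^ (α + 3) * E) * latticeDecay 3 j := by
        rw [hsplit]
        ring
    _ ≤ _ := mul_le_mul_of_nonneg_right (mul_le_mul_of_nonneg_left
        (one_add_rpow_mul_exp_neg_sq_max_le (by positivity) hκ hσ (norm_nonneg j))
        (by positivity)) (latticeDecay_nonneg 3 j)

namespace PointConfig

variable {m : ℕ} {α : ℝ}

/-- The summand of `voidSum` at cone `k` and lattice cell `j`, with the inner ball shrunk by `2` so
that it bounds this summand simultaneously for all translations of the configuration by a vector of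
the unit square. -/
noncomputable def voidTerm (α a : ℝ) (k : Fin m) (j : Fin 2 → ℤ) : PointConfig → ℝ≥0∞ :=
  {φ | φ.count (innerBall m k (‖j‖ - 1) 2) = 0}.indicator fun φ =>
    ENNReal.ofReal ((2 * (‖j‖ + 1)) ^ α) *
      eexp (φ.shotNoise (unitSquare 0) fun i => a * latticeDecay α (i - j))

theorem measurableSet_count_innerBall_eq_zero (k : Fin m) (ρ d : ℝ) :
    MeasurableSet {φ : PointConfig | φ.count (innerBall m k ρ d) = 0} :=
  measurable_count measurableSet_innerBall isBounded_innerBall (measurableSet_singleton 0)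

theorem measurable_voidTerm (α a : ℝ) (k : Fin m) (j : Fin 2 → ℤ) :
    Measurable (voidTerm α a k j) :=
  ((continuous_eexp.measurable.comp (measurable_shotNoise (measurableSet_unitSquare 0)
    (isBounded_unitSquare 0))).const_mul _).indicator (measurableSet_count_innerBall_eq_zero _ _ _)

theorem latticeShotNoise_sub_le (hα : 0 ≤ α) (φ : PointConfig) {w : Plane}
    (hw : latticeCell w = 0) (j : Fin 2 → ℤ) :
    latticeShotNoise α (fun z : φ.points => (z : Plane) - w) j ≤
      φ.shotNoise (unitSquare 0) fun i => 2 ^ α * latticeDecay α (i - j) := by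
  rw [shotNoise_unitSquare]
  refine ENNReal.tsum_le_tsum fun z => ENNReal.ofReal_le_ofReal ?_
  refine latticeDecay_le_of_norm_sub_le_one hα ?_
  rw [sub_zero, sub_sub_sub_cancel_right]
  exact norm_latticeCell_sub_sub_le_one hw z

theorem voidSum_translate_le (hα : 0 ≤ α) (A : ℝ≥0) (φ : PointConfig) (x : Plane) {w : Plane}
    (hw : w ∈ unitSquare 0 0) :
    voidSum m α A (fun z : (φ.translate (x - w)).points => (z : Plane) - x) ≤
      ∑' (k : Fin m) (j : Fin 2 → ℤ), φ.voidTerm α (A * 2 ^ α) k j := by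
  have hcell : latticeCell w = 0 := by rwa [unitSquare, Set.mem_ofPred_eq, sub_zero] at hw
  have hnorm : ‖w‖ ≤ 2 := by
    simpa only [hcell, norm_zero, zero_add, mul_one] using norm_le_two_mul_norm_latticeCell w
  let e : φ.points ≃ (φ.translate (x - w)).points :=
    Equiv.Set.image _ φ.points (add_left_injective (x - w))
  have he : (fun z : (φ.translate (x - w)).points => (z : Plane) - x) ∘ e =
      fun z : φ.points => (z : Plane) - w :=
    funext fun z => show (z : Plane) + (x - w) - x = z - w by abel
  rw [← voidSum_comp_equiv e, he]
  refine ENNReal.tsum_le_tsum fun k => ENNReal.tsum_le_tsum fun j => ?_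
  split_ifs with hvoid
  · have hmem : φ ∈ {φ : PointConfig | φ.count (innerBall m k (‖j‖ - 1) 2) = 0} :=
      (φ.count_eq_zero_iff isBounded_innerBall).mpr fun z hball =>
        hvoid z (sub_mem_innerBall_zero hball hnorm)
    rw [voidTerm, Set.indicator_of_mem hmem]
    gcongr
    refine eexp_mono ?_
    simp only [mul_assoc, φ.shotNoise_const_mul A.coe_nonneg, ENNReal.ofReal_coe_nnreal]
    gcongr
    exact φ.latticeShotNoise_sub_le hα hcell j
  · exact zero_le

theorem count_mul_voidTerm_le {a : ℝ} (ha : 0 ≤ a) (k : Fin m) (j : Fin 2 → ℤ)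
    (φ : PointConfig) :
    φ.count (unitSquare 0 0) * φ.voidTerm α a k j ≤
      {φ : PointConfig | φ.count (innerBall m k (‖j‖ - 1) 2) = 0}.indicator
        (fun φ => ENNReal.ofReal ((2 * (‖j‖ + 1)) ^ α) * eexp (φ.shotNoise (unitSquare 0)
          ((fun i => a * latticeDecay α (i - j)) + Pi.single 0 1))) φ := by
  rw [voidTerm, ← Set.indicator_const_mul]
  refine Set.indicator_le_indicator ?_
  rw [mul_left_comm]
  gcongr
  exact count_mul_eexp_shotNoise_le (fun i => mul_nonneg ha (latticeDecay_nonneg _ _)) 0 φ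

end PointConfig

theorem hasSum_mul_latticeDecay_sub_add_single {α : ℝ} (hα : 2 < α) (a : ℝ) (j : Fin 2 → ℤ) :
    HasSum ((fun i => a * latticeDecay α (i - j)) + Pi.single 0 1)
      (a * ∑' i, latticeDecay α i + 1) :=
  (((Equiv.subRight j).hasSum_iff.mpr (summable_latticeDecay hα).hasSum).mul_left a).add
    (hasSum_pi_single 0 1)

theorem IsPoissonLaw.lintegral_count_mul_voidTerm_le {lam : ℝ} {P : Measure PointConfig}
    (hP : IsPoissonLaw lam P) (hlam : 0 ≤ lam) {m : ℕ} {α a : ℝ} (hα : 2 < α) (ha : 0 ≤ a)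
    (k : Fin m) (j : Fin 2 → ℤ) :
    ∫⁻ φ, φ.count (unitSquare 0 0) * φ.voidTerm α a k j ∂P ≤
      ENNReal.ofReal ((2 * (‖j‖ + 1)) ^ α * Real.exp (-(lam * Real.pi / 2 *
        max ((‖j‖ - 1) / 2 * Real.sin (Real.pi / m) - 2) 0 ^ 2))) *
      ENNReal.ofReal (Real.exp
        (lam * (Real.exp (2 * (a + 1)) * (a * ∑' i, latticeDecay α i + 1)))) := by
  set g : (Fin 2 → ℤ) → ℝ := (fun i => a * latticeDecay α (i - j)) + Pi.single 0 1
  have hg : 0 ≤ g := add_nonneg (fun i => mul_nonneg ha (latticeDecay_nonneg _ _))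
    (Pi.single_nonneg.mpr zero_le_one)
  have hgb (i) : g i ≤ a + 1 := by
    refine add_le_add (mul_le_of_le_one_right ha (latticeDecay_le_one (by linarith) _)) ?_
    rw [Pi.single_apply]
    split_ifs <;> norm_num
  have hgsum : HasSum g _ := hasSum_mul_latticeDecay_sub_add_single hα a j
  have hvol (i) : (volume : Measure Plane).real (unitSquare 0 i) = 1 := by
    rw [Measure.real, volume_unitSquare_zero, ENNReal.toReal_one]
  have hvoid := hP.setLIntegral_void_eexp_shotNoise_le hlam (measurableSet_unitSquare 0)
    (isBounded_unitSquare 0) (pairwise_disjoint_unitSquare 0) hg hgb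
    (by simpa only [hvol, one_mul] using hgsum.summable)
    (D := innerBall m k (‖j‖ - 1) 2) measurableSet_innerBall isBounded_innerBall
  simp only [hvol, one_mul, hgsum.tsum_eq, volume_real_innerBall] at hvoid
  refine (lintegral_mono (PointConfig.count_mul_voidTerm_le ha k j)).trans ?_
  rw [lintegral_indicator (PointConfig.measurableSet_count_innerBall_eq_zero _ _ _),
    lintegral_const_mul' _ _ ENNReal.ofReal_ne_top, ENNReal.ofReal_mul (by positivity), mul_assoc]
  grw [hvoid]
  refine le_of_eq ?_
  congr 4
  ring

theorem IsPalmLaw.lintegral_voidSum_lt_top {lam : ℝ} (hlam : 0 < lam) {P Q : Measure PointConfig}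
    {x : Plane} (hQ : IsPalmLaw lam P x Q) (hP : IsPoissonLaw lam P) {m : ℕ} (hm : 1 < m) {α : ℝ}
    (hα : 2 < α) {A : ℝ≥0∞} (hA : A ≠ ∞) :
    ∫⁻ φ, voidSum m α A (fun z : φ.points => (z : Plane) - x) ∂Q < ∞ := by
  lift A to ℝ≥0 using hA
  have hcampbell := hQ.mul_lintegral_le (measurableSet_unitSquare 0 0) (isBounded_unitSquare 0 0)
    (F := fun φ => voidSum m α A (fun z : φ.points => (z : Plane) - x))
    fun φ w hw => PointConfig.voidSum_translate_le (by linarith) A φ x hw.2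
  rw [volume_unitSquare_zero, mul_one] at hcampbell
  suffices hsum : ∫⁻ φ, φ.count (unitSquare 0 0) *
      ∑' (k : Fin m) (j : Fin 2 → ℤ), φ.voidTerm α (A * 2 ^ α) k j ∂P < ∞ from
    ENNReal.lt_top_of_mul_ne_top_right (hcampbell.trans_lt hsum).ne
      (ENNReal.ofReal_pos.mpr hlam).ne'
  have hmeas (k : Fin m) (j) : Measurable fun φ : PointConfig =>
      φ.count (unitSquare 0 0) * φ.voidTerm α (A * 2 ^ α) k j :=
    ((measurable_of_countable ((↑) : ℕ → ℝ≥0∞)).comp (PointConfig.measurable_count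
      (measurableSet_unitSquare 0 0) (isBounded_unitSquare 0 0))).mul
        (PointConfig.measurable_voidTerm _ _ k j)
  simp only [← ENNReal.tsum_mul_left]
  rw [lintegral_tsum fun k => (Measurable.tsum fun j => hmeas k j).aemeasurable, tsum_fintype,
    ENNReal.sum_lt_top]
  intro k _
  rw [lintegral_tsum fun j => (hmeas k j).aemeasurable]
  have hm1 : (1 : ℝ) < m := by exact_mod_cast hm
  have hsin : 0 < Real.sin (Real.pi / m) :=
    Real.sin_pos_of_pos_of_lt_pi (by positivity) (div_lt_self Real.pi_pos hm1)
  grw [ENNReal.tsum_le_tsum fun j =>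
    hP.lintegral_count_mul_voidTerm_le hlam.le hα (by positivity) k j, ENNReal.tsum_mul_right]
  exact ENNReal.mul_lt_top (summable_rpow_mul_exp_neg_sq (by linarith) (by positivity)
    hsin).tsum_ofReal_lt_top ENNReal.ofReal_lt_top

namespace IsNetwork

variable {Ω : Type*} [MeasurableSpace Ω] {m : ℕ} {S : Network Ω m} {p : SINRParams}
  {Pr : Measure Ω} {Q : Measure PointConfig} {x : Plane}

theorem lintegral_voidSum_eq (h : IsNetwork S p Pr Q x) (α : ℝ) (A : ℝ≥0∞) :
    ∫⁻ ω, voidSum m α A (fun i => S.pos i ω - x) ∂Pr =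
      ∫⁻ φ, voidSum m α A (fun z : φ.points => (z : Plane) - x) ∂Q := by
  rw [← h.config_law.lintegral_comp (PointConfig.measurable_voidSum m α A x).aemeasurable]
  refine lintegral_congr_ae (h.pos_enum.mono fun ω ⟨hinj, hrange⟩ => ?_)
  let e : ℕ ≃ (S.config ω).points := (Equiv.ofInjective _ hinj).trans (Equiv.setCongr hrange)
  exact voidSum_comp_equiv (f := fun z : (S.config ω).points => (z : Plane) - x) e

theorem lintegral_exitTime_zero_le [IsFiniteMeasure Pr] (h : IsNetwork S p Pr Q x)
    (hα : 0 < p.alpha) (hμ : 0 < p.mu) (hβ : 0 < p.beta) (hγ : 0 ≤ p.gamma) (hN : 0 ≤ p.noise)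
    (hM : 0 < p.avgPower) (hm : 2 < m) (he0 : 0 < p.eps) (he : p.eps < 1)
    (hfin : ∫⁻ ω, voidSum m p.alpha p.noiseFactor (fun i => S.pos i ω - x) ∂Pr ≠ ∞) :
    ∫⁻ ω, S.exitTime p 0 ω ∂Pr ≤ ENNReal.ofReal p.successConst *
      ∫⁻ ω, voidSum m p.alpha p.noiseFactor (fun i => S.pos i ω - x) ∂Pr := by
  set W : Ω → ℝ≥0∞ := fun ω => voidSum m p.alpha p.noiseFactor fun i => S.pos i ω - x
  have hWm (t : ℕ) : Measurable[S.history t] W := by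
    let _ := S.history t
    exact measurable_voidSum m _ _ fun i =>
      (measurable_id.sub_const x).comp (S.measurable_pos_history t i)
  have hW : Measurable W := (hWm 0).mono (h.history_le 0) le_rfl
  have hWt : ∀ᵐ ω ∂Pr, W ω ≠ ∞ := (ae_lt_top hW hfin).mono fun _ hω => hω.ne
  have hC : ENNReal.ofReal p.successConst ≠ 0 :=
    (ENNReal.ofReal_pos.mpr (SINRParams.successConst_pos he0 he)).ne'
  rw [← lintegral_const_mul _ hW]
  refine h.lintegral_exitTime_le hα.ne' hμ hM he0 he hβ hγ hN 0 (fun t => ?_) ?_ ?_ fun t => ?_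
  · exact (measurable_const_mul _).comp (hWm t)
  · exact ae_of_all _ fun ω =>
      mul_ne_zero hC (one_pos.trans_le (one_le_voidSum (by lia) hα.le)).ne'
  · exact hWt.mono fun ω hω => ENNReal.mul_ne_top ENNReal.ofReal_ne_top hω
  · filter_upwards [h.pos_enum, h.pos_zero, hWt] with ω ⟨hinj, hrange⟩ hzero hωt
    simp only [W, ← hzero] at hωt ⊢
    exact Network.invSuccessBound_le_voidSum hm hα hinj hrange hωt

end IsNetwork

theorem theorem1_general {p : SINRParams} (hα : 2 < p.alpha) (hμ : 0 < p.mu) (hβ : 0 < p.beta)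
    (hγ : 0 ≤ p.gamma) (hN : 0 ≤ p.noise) (hM : 0 < p.avgPower) (he0 : 0 < p.eps)
    (he : p.eps < 1) {m : ℕ} (hm : 2 < m) {lam : ℝ} (hlam : 0 < lam) {P Q : Measure PointConfig}
    (hP : IsPoissonLaw lam P) {x : Plane} (hQ : IsPalmLaw lam P x Q) {Ω : Type*}
    [MeasurableSpace Ω] {Pr : Measure Ω} [IsFiniteMeasure Pr] {S : Network Ω m}
    (h : IsNetwork S p Pr Q x) :
    AEMeasurable (S.exitTime p 0) Pr ∧ ∫⁻ ω, S.exitTime p 0 ω ∂Pr < ∞ := by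
  have hvoid : ∫⁻ ω, voidSum m p.alpha p.noiseFactor (fun i => S.pos i ω - x) ∂Pr < ∞ := by
    rw [h.lintegral_voidSum_eq]
    exact hQ.lintegral_voidSum_lt_top hlam hP (by lia) hα (SINRParams.noiseFactor_ne_top hμ)
  refine ⟨(Network.measurable_exitTime p h.measurable_pos h.measurable_dest h.measurable_isOn
    h.measurable_fade 0).aemeasurable, ?_⟩
  calc ∫⁻ ω, S.exitTime p 0 ω ∂Pr
      ≤ ENNReal.ofReal p.successConst *
          ∫⁻ ω, voidSum m p.alpha p.noiseFactor (fun i => S.pos i ω - x) ∂Pr :=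
        h.lintegral_exitTime_zero_le (by linarith) hμ hβ hγ hN hM hm he0 he hvoid.ne
    _ < ∞ := ENNReal.mul_lt_top ENNReal.ofReal_lt_top hvoid

theorem two_lt_of_two_mul_pi_div_lt {m : ℕ} (hm0 : 0 < m)
    (hm : 2 * (Real.pi / m) < Real.pi / 2) : 2 < m := by
  have hm0' : (0 : ℝ) < m := Nat.cast_pos.mpr hm0
  rw [← mul_div_assoc, div_lt_div_iff₀ hm0' two_pos] at hm
  have hm4 : (2 * 2 : ℝ) < m := by nlinarith [Real.pi_pos]
  exact_mod_cast (by linarith : (2 : ℝ) < m)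

theorem theorem1
    (α μ β γ N M : ℝ) (hα : 2 < α) (hμ : 0 < μ) (hβ : 0 < β) (hγ : 0 < γ) (hγ1 : γ < 1)
    (hN : 0 ≤ N) (hM : 0 < M) (m : ℕ) (hm0 : 0 < m)
    (hm : 2 * (Real.pi / m) < Real.pi / 2)
    (hβγ : β * γ < 1) :
    ∃ ε₀ : ℝ, 0 < ε₀ ∧ ε₀ ≤ 1 ∧ ∀ ε : ℝ, 0 < ε → ε < ε₀ →
      ∀ lam : ℝ, 0 < lam →
      ∀ P : Measure PointConfig, IsPoissonLaw lam P →
      ∀ (x : Plane) (Q : Measure PointConfig), IsPalmLaw lam P x Q →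
      ∀ {Ω : Type*} [MeasurableSpace Ω] (Pr : Measure Ω) [IsProbabilityMeasure Pr]
        (S : Network Ω m),
        IsNetwork S ⟨α, μ, β, γ, N, M, ε⟩ Pr Q x →
        AEMeasurable (S.exitTime ⟨α, μ, β, γ, N, M, ε⟩ 0) Pr ∧
          ∫⁻ ω, S.exitTime ⟨α, μ, β, γ, N, M, ε⟩ 0 ω ∂Pr < ∞ := by
  exact ⟨1, one_pos, le_rfl, fun _ he0 he _ hlam _ hP _ _ hQ _ _ _ _ _ h =>
    theorem1_general hα hμ hβ hγ.le hN hM he0 he (two_lt_of_two_mul_pi_div_lt hm0 hm) hlam hP hQ h⟩
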